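/- Dueling bandits with linear realizability. Fix $d,K,T\in\mathbb N$ and a context set $\mathcal X\subseteq[-1,1]^{K\times K\times d}$; a context $x$ assigns a feature vector $x[a,b]\in[-1,1]^d$ to each pair $(a,b)\in[K]^2$. For $w\in[-1,1]^d$ let $f_w(x)[a,b]=w^\top x[a,b]$, and let $\mathcal F$ be the class of all $f_w$, $w\in[-1,1]^d$, with $f_w(x)\in[-1,1]^{K\times K}$ for all $x\in\mathcal X$. Assume that every $f\in\mathcal F$ is skew-symmetric on every context, $f(x)[a,b]=-f(x)[b,a]$ for all $x\in\mathcal X$. Let $\mathcal D$ be a probability distribution of pairs $(x,P)$ with $x\in\mathcal X$, $P\in[-1,1]^{K\times K}$ and $\mathbb E[P\mid x]=f_w(x)$ for some $f_w\in\mathcal F$ unknown to the learner. In round $t=1,\dots,T$ a pair $(x_t,P_t)\sim\mathcal D$ is drawn independently of the past, the learner sees $x_t$ and, from this and its past observations, chooses a distribution $p_t$ on $[K]^2$; a duel $(a_t,b_t)\sim p_t$ is played and the learner observes $o_t\in\{\pm1\}$, where $\Pr(o_t=1)=(P_t[a_t,b_t]+1)/2$ conditionally on everything before. Let $$\mathrm{BR\text{-}Regret}_T=\sum_{t=1}^T\max_{q\in\Delta_K}\tfrac12\,\mathbb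 E_{c\sim q}\,\mathbb E_{(a,b)\sim p_t}\bigl[f_w(x_t)[c,a]+f_w(x_t)[c,b]\bigr].$$ The algorithm CCE-linDB with parameters $\lambda,\eta>0$ computes in round $t$ the matrix $V_t=\lambda I+\sum_{s<t}x_s[a_s,b_s]x_s[a_s,b_s]^\top$, the ridge estimate $\hat w_t=V_t^{-1}\sum_{s<t}o_s\,x_s[a_s,b_s]$ and the upper confidence matrix $U_t[a,b]=\hat w_t^\top x_t[a,b]+\eta\sqrt{x_t[a,b]^\top V_t^{-1}x_t[a,b]}$ for $a\ne b$, $U_t[a,a]=0$. It takes for $p_t$ any coarse correlated equilibrium of $U_t$, that is, any distribution $p$ on $[K]^2$, with left and right marginals $p^\ell$ and $p^r$, such that $\sum_{a,b}p[a,b]U_t[a,b]\ge\max_{a'}\sum_b p^r[b]U_t[a',b]$ and $\sum_{a,b}p[a,b]U_t[b,a]\ge\max_{b'}\sum_a p^\ell[a]U_t[b',a]$. Theorem. There are a universal constant $C>0$ and a tuning $\lambda=\lambda(d,K,T)>0$, $\eta=\eta(d,K,T)>0$ such that, for all $d,K,T$, all $\mathcal X$, $\mathcal D$, $w$ as above and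 every choice of the equilibria $p_t$, the expected best-response regret of CCE-linDB satisfies $$\mathbb E\bigl[\mathrm{BR\text{-}Regret}_T\bigr]\le C\,d\,\log(KT)\,\sqrt T.$$ -/

import Mathlib

open MeasureTheory ProbabilityTheory
open scoped Matrix

noncomputable section

namespace DuelingBandit

/-- A context: a feature vector `x a b : Fin d → ℝ` for every ordered pair of actions. -/
abbrev Context (K d : ℕ) : Type := Fin K → Fin K → Fin d → ℝ

/-- A real `K × K` matrix, indexed by pairs of actions. -/
abbrev PairMatrix (K : ℕ) : Type := Fin K → Fin K → ℝ

/-- The linear preference function `f_w (x) [a, b] = wᵀ x[a, b]`. -/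
def linPref {K d : ℕ} (w : Fin d → ℝ) (x : Context K d) : PairMatrix K :=
  fun a b => w ⬝ᵥ x a b

/-- `M` has all its entries in `[-1, 1]`. -/
def Bounded {K : ℕ} (M : PairMatrix K) : Prop :=
  ∀ a b, M a b ∈ Set.Icc (-1 : ℝ) 1

/-- `M` is skew-symmetric (so it has a zero diagonal): the payoff matrix of a symmetric
zero-sum game. -/
def IsSkew {K : ℕ} (M : PairMatrix K) : Prop :=
  ∀ a b, M a b = -M b a

/-- The parameters `w ∈ [-1, 1]^d` of the linear function class on the context set `X`: those
for which `f_w` maps `X` into `[-1, 1]^{K × K}`. -/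
def linClass {K d : ℕ} (X : Set (Context K d)) : Set (Fin d → ℝ) :=
  {w | (∀ i, w i ∈ Set.Icc (-1 : ℝ) 1) ∧ ∀ x ∈ X, Bounded (linPref w x)}

/-- The setting of dueling bandits with linear realizability: contexts in `X`, contained in
`[-1, 1]^{K × K × d}`; every function of the class is skew-symmetric on every context; the
context-preference pairs have law `D`; and `w` is the true (unknown) parameter. -/
structure IsLinDB {K d : ℕ} (X : Set (Context K d)) (D : Measure (Context K d × PairMatrix K))
    (w : Fin d → ℝ) : Prop where
  /-- features lie in `[-1, 1]` -/
  feature_mem : ∀ x ∈ X, ∀ a b i, x a b i ∈ Set.Icc (-1 : ℝ) 1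
  /-- every function of the class is skew-symmetric on every context -/
  skew : ∀ v ∈ linClass X, ∀ x ∈ X, IsSkew (linPref v x)
  /-- `D` is a probability distribution -/
  prob : IsProbabilityMeasure D
  /-- contexts belong to the context set -/
  context_mem : ∀ᵐ z ∂D, z.1 ∈ X
  /-- preference matrices have entries in `[-1, 1]` -/
  pref_mem : ∀ᵐ z ∂D, Bounded z.2
  /-- the true parameter belongs to the class -/
  param_mem : w ∈ linClass X
  /-- realizability: `E[P[a, b] | x] = f_w (x) [a, b]` -/
  realizable : ∀ a b,
    D[fun z => z.2 a b | MeasurableSpace.comap Prod.fst inferInstance]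
      =ᵐ[D] fun z => linPref w z.1 a b

/-- Joint distributions on pairs of actions. -/
def IsJointDist {K : ℕ} (p : PairMatrix K) : Prop :=
  (∀ a b, 0 ≤ p a b) ∧ ∑ a, ∑ b, p a b = 1

/-- The left marginal. -/
def leftMarginal {K : ℕ} (p : PairMatrix K) (a : Fin K) : ℝ := ∑ b, p a b

/-- The right marginal. -/
def rightMarginal {K : ℕ} (p : PairMatrix K) (b : Fin K) : ℝ := ∑ a, p a b

/-- `p` is a coarse correlated equilibrium of the matrix `U`: a joint distribution such that
neither player gains by a unilateral deviation to a fixed action. -/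
structure IsCCE {K : ℕ} (U p : PairMatrix K) : Prop where
  dist : IsJointDist p
  row : ∀ a' : Fin K, ∑ b, rightMarginal p b * U a' b ≤ ∑ a, ∑ b, p a b * U a b
  col : ∀ b' : Fin K, ∑ a, leftMarginal p a * U b' a ≤ ∑ a, ∑ b, p a b * U b a

/-- The random variables of an interaction on the sample space `Ω`; rounds are numbered from
`0`. In round `t`, `x t` is the context, `P t` the (hidden) preference matrix, `p t` the joint
distribution chosen by the learner, `(a t, b t)` the duel, and `o t` the outcome. -/
structure Interaction (Ω : Type*) (K d : ℕ) where
  x : ℕ → Ω → Context K d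
  P : ℕ → Ω → PairMatrix K
  p : ℕ → Ω → PairMatrix K
  a : ℕ → Ω → Fin K
  b : ℕ → Ω → Fin K
  o : ℕ → Ω → ℝ

namespace Interaction

variable {Ω : Type*} {K d : ℕ} (S : Interaction Ω K d)

/-- Everything that happened in the rounds before `t`. -/
def past (t : ℕ) (ω : Ω) : Fin t → Context K d × PairMatrix K × Fin K × Fin K × ℝ :=
  fun s => (S.x s ω, S.P s ω, S.a s ω, S.b s ω, S.o s ω)

/-- What the learner has observed in the rounds before `t` (not the matrices `P s`). -/
def observed (t : ℕ) (ω : Ω) : Fin t → Context K d × Fin K × Fin K × ℝ :=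
  fun s => (S.x s ω, S.a s ω, S.b s ω, S.o s ω)

/-- The information on which the learner bases `p t`: its past observations and the current
context. -/
abbrev learnerInfo (t : ℕ) : MeasurableSpace Ω :=
  MeasurableSpace.comap (fun ω => (S.observed t ω, S.x t ω)) inferInstance

/-- The information present when the duel of round `t` is drawn. -/
abbrev preDuel (t : ℕ) : MeasurableSpace Ω :=
  MeasurableSpace.comap (fun ω => (S.past t ω, S.x t ω, S.P t ω)) inferInstance

/-- The information present when the outcome of round `t` is drawn. -/
abbrev preOutcome (t : ℕ) : MeasurableSpace Ω :=
  MeasurableSpace.comap (fun ω => (S.past t ω, S.x t ω, S.P t ω, S.a t ω, S.b t ω)) inferInstance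

/-- The dueling bandit protocol over `T` rounds with context-preference distribution `D`, for
an arbitrary learner that draws its duel in round `t` from `p t`. -/
structure IsDuelingBandit [MeasurableSpace Ω] (μ : Measure Ω) (T : ℕ)
    (D : Measure (Context K d × PairMatrix K)) : Prop where
  measurable_x : ∀ t < T, Measurable (S.x t)
  measurable_P : ∀ t < T, Measurable (S.P t)
  measurable_a : ∀ t < T, Measurable (S.a t)
  measurable_b : ∀ t < T, Measurable (S.b t)
  measurable_o : ∀ t < T, Measurable (S.o t)
  /-- the context-preference pair of every round has law `D` -/
  law : ∀ t < T, μ.map (fun ω => (S.x t ω, S.P t ω)) = D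
  /-- and it is independent of the past -/
  indep : ∀ t < T, IndepFun (S.past t) (fun ω => (S.x t ω, S.P t ω)) μ
  /-- the learner's distribution depends only on what it has seen -/
  adapted : ∀ t < T, Measurable[S.learnerInfo t] (S.p t)
  dist : ∀ t < T, ∀ᵐ ω ∂μ, IsJointDist (S.p t ω)
  /-- the duel is drawn from `p t` -/
  duel : ∀ t < T, ∀ i j,
    μ[Set.indicator {ω | S.a t ω = i ∧ S.b t ω = j} (fun _ => (1 : ℝ)) | S.preDuel t]
      =ᵐ[μ] fun ω => S.p t ω i j
  outcome_mem : ∀ t < T, ∀ᵐ ω ∂μ, S.o t ω = 1 ∨ S.o t ω = -1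
  /-- the first action wins with conditional probability `(P t [a t, b t] + 1) / 2` -/
  outcome : ∀ t < T,
    μ[Set.indicator {ω | S.o t ω = 1} (fun _ => (1 : ℝ)) | S.preOutcome t]
      =ᵐ[μ] fun ω => (S.P t ω (S.a t ω) (S.b t ω) + 1) / 2

/-- The design matrix, whose rows are the features of the duels played before round `t`. -/
def design (t : ℕ) (ω : Ω) : Matrix (Fin t) (Fin d) ℝ :=
  Matrix.of fun s => S.x s ω (S.a s ω) (S.b s ω)

/-- The vector of the outcomes before round `t`. -/
def response (t : ℕ) (ω : Ω) : Fin t → ℝ := fun s => S.o s ω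

/-- `V_t = λ I + ∑_{s < t} x_s[a_s, b_s] x_s[a_s, b_s]ᵀ`. -/
def gram (lam : ℝ) (t : ℕ) (ω : Ω) : Matrix (Fin d) (Fin d) ℝ :=
  lam • (1 : Matrix (Fin d) (Fin d) ℝ) + ∑ s ∈ Finset.range t,
    Matrix.vecMulVec (S.x s ω (S.a s ω) (S.b s ω)) (S.x s ω (S.a s ω) (S.b s ω))

/-- The ridge regression estimate `(Xᵀ X + λ I)⁻¹ Xᵀ Y`. -/
def ridge (lam : ℝ) (t : ℕ) (ω : Ω) : Fin d → ℝ :=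
  ((S.design t ω)ᵀ * S.design t ω + lam • (1 : Matrix (Fin d) (Fin d) ℝ))⁻¹ *ᵥ
    ((S.design t ω)ᵀ *ᵥ S.response t ω)

/-- The upper confidence matrix: estimated preference plus `η` times the width of the
confidence ellipsoid in the direction `x_t[a, b]`, and `0` on the diagonal. -/
def ucb (lam η : ℝ) (t : ℕ) (ω : Ω) : PairMatrix K := fun a b =>
  if a = b then 0
  else S.ridge lam t ω ⬝ᵥ S.x t ω a b +
    η * √(S.x t ω a b ⬝ᵥ ((S.gram lam t ω)⁻¹ *ᵥ S.x t ω a b))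

/-- The learner plays according to `CCE-linDB` with regularizer `lam` and confidence radius
`η`: in every round, `p t` is a (measurably chosen, otherwise arbitrary) coarse correlated
equilibrium of the upper confidence matrix. -/
def PlaysCCElinDB [MeasurableSpace Ω] (μ : Measure Ω) (T : ℕ) (lam η : ℝ) : Prop :=
  ∀ t < T, ∀ᵐ ω ∂μ, IsCCE (S.ucb lam η t ω) (S.p t ω)

/-- The best-response regret over `T` rounds when the true parameter is `w`:
`∑_t max_{q ∈ Δ_K} ½ E_{c ∼ q} E_{(a, b) ∼ p_t} [f_w (x_t) [c, a] + f_w (x_t) [c, b]]`. -/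
def brRegret (w : Fin d → ℝ) (T : ℕ) (ω : Ω) : ℝ :=
  ∑ t ∈ Finset.range T, ⨆ q : stdSimplex ℝ (Fin K),
    (1 / 2 : ℝ) * ∑ c, q.1 c * ∑ a, ∑ b, S.p t ω a b *
      (linPref w (S.x t ω) c a + linPref w (S.x t ω) c b)

end Interaction

end DuelingBandit

end

/-! Take `λ = 1`. Suppose the confidence ellipsoid contains `w`, so that `f_w ≤ U_t` entrywise. The
two equilibrium inequalities for a deviation `c`, added up, bound the gain of `c` by `½ ∑ p_t[a,b]
(U_t[a,b] + U_t[b,a])` (`IsCCE.deviation_le`). The unit vectors belong to the class, so the features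
themselves are skew (`IsLinDB.feature_skew`): the estimates cancel and `η` times the mean width
under `p_t` remains. In expectation this is the width at the duel played. The elliptical potential
lemma and Cauchy–Schwarz sum these widths to order `√(d T log T)`, plus `d^{3/2} log T`, because
with `λ = 1` a width can be as large as `√d` (`sum_pairWidth_le`).

For the confidence, let `S_t` be the noise-weighted sum of the features. The process `M_t =
det(V_t)^{-1/2} exp(S_tᵀ V_t⁻¹ S_t / 2)` has expectation at most `1`
(`integral_mixSupermart_le_one`). This is the method of mixtures done one round at a time: the
Gaussian with mean `V⁻¹ S` and covariance `V⁻¹`, projected on the new feature, is one-dimensional,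
so a step is a Gaussian average of Hoeffding's lemma (`sign_mixture_le`). If `M_t < T`, the
ellipsoid contains `w`; if not, the regret of the round is at most `1 ≤ M_t / T`. Failures thus cost
`1 / T` per round in expectation, without a maximal inequality or a union bound (`roundRegret_le`).

The product of `η` and the total width is `d log(KT) √T` up to a term `d² log(KT)^{3/2}`, which is
absorbed when `√T ≥ d √log(KT)`; otherwise the trivial bound `T` suffices (`regret_bound_le`). -/

noncomputable section

namespace DuelingBandit

/-! ### The quadratic form of an inverse matrix, rank-one updates and determinants. -/

section InverseForm

variable {n : Type*} [Fintype n] [DecidableEq n] {V : Matrix n n ℝ} {x y : n → ℝ}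

/-- The bilinear form `xᵀ V⁻¹ y` of the inverse of a matrix. -/
def invForm (V : Matrix n n ℝ) (x y : n → ℝ) : ℝ := x ⬝ᵥ (V⁻¹ *ᵥ y)

theorem invForm_add_right (V : Matrix n n ℝ) (x y z : n → ℝ) :
    invForm V x (y + z) = invForm V x y + invForm V x z := by
  simp [invForm, Matrix.mulVec_add]

theorem invForm_add_left (V : Matrix n n ℝ) (x y z : n → ℝ) :
    invForm V (x + y) z = invForm V x z + invForm V y z := by
  simp [invForm]

theorem invForm_smul_right (V : Matrix n n ℝ) (c : ℝ) (x y : n → ℝ) :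
    invForm V x (c • y) = c * invForm V x y := by
  simp [invForm, Matrix.mulVec_smul]

theorem invForm_smul_left (V : Matrix n n ℝ) (c : ℝ) (x y : n → ℝ) :
    invForm V (c • x) y = c * invForm V x y := by
  simp [invForm]

theorem invForm_comm (hV : V.PosDef) (x y : n → ℝ) : invForm V x y = invForm V y x := by
  have h : (V⁻¹)ᵀ = V⁻¹ := by
    have := hV.inv.isHermitian
    rwa [Matrix.IsHermitian, Matrix.conjTranspose_eq_transpose_of_trivial] at this
  unfold invForm
  rw [Matrix.dotProduct_mulVec, ← Matrix.mulVec_transpose, h, dotProduct_comm]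

theorem invForm_self_nonneg (hV : V.PosDef) (x : n → ℝ) : 0 ≤ invForm V x x := by
  simpa [invForm] using hV.inv.posSemidef.dotProduct_mulVec_nonneg x

/-- Cauchy–Schwarz: the quadratic polynomial `t ↦ invForm V (x + t • y) (x + t • y)` is nonnegative,
so its discriminant is not positive. -/
theorem invForm_sq_le (hV : V.PosDef) (x y : n → ℝ) :
    invForm V x y ^ 2 ≤ invForm V x x * invForm V y y := by
  have h : ∀ t : ℝ, 0 ≤ invForm V y y * (t * t) + 2 * invForm V x y * t + invForm V x x := by
    intro t
    have := invForm_self_nonneg hV (x + t • y)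
    simp only [invForm_add_left, invForm_add_right, invForm_smul_left, invForm_smul_right,
      invForm_comm hV y x] at this
    linarith
  have := discrim_le_zero h
  unfold discrim at this
  linarith

theorem abs_invForm_le (hV : V.PosDef) (x y : n → ℝ) :
    |invForm V x y| ≤ √(invForm V x x) * √(invForm V y y) := by
  rw [← Real.sqrt_mul (invForm_self_nonneg hV x)]
  exact Real.abs_le_sqrt (invForm_sq_le hV x y)

omit [DecidableEq n] in
theorem posDef_add_vecMulVec_self (hV : V.PosDef) (x : n → ℝ) :
    (V + Matrix.vecMulVec x x).PosDef := by
  refine hV.add_posSemidef ?_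
  simpa using Matrix.posSemidef_vecMulVec_self_star x

theorem det_add_vecMulVec_self (hV : V.PosDef) (x : n → ℝ) :
    (V + Matrix.vecMulVec x x).det = V.det * (1 + invForm V x x) := by
  have hu : IsUnit V.det := (Matrix.isUnit_iff_isUnit_det V).1 hV.isUnit
  rw [Matrix.vecMulVec_eq Unit, Matrix.det_add_replicateCol_mul_replicateRow hu]
  congr 2
  simp [Matrix.det_unique, invForm, Matrix.mul_apply, dotProduct, Matrix.mulVec, Finset.mul_sum,
    Finset.sum_mul]
  rw [Finset.sum_comm]
  simp [mul_assoc]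

/-- The Sherman–Morrison formula, checked by applying `V + x xᵀ` to the right-hand side. -/
theorem add_vecMulVec_self_inv_mulVec (hV : V.PosDef) (x y : n → ℝ) :
    (V + Matrix.vecMulVec x x)⁻¹ *ᵥ y =
      V⁻¹ *ᵥ y - (invForm V x y / (1 + invForm V x x)) • (V⁻¹ *ᵥ x) := by
  have hq := invForm_self_nonneg hV x
  have hV1 : V * V⁻¹ = 1 := Matrix.mul_nonsing_inv _ ((Matrix.isUnit_iff_isUnit_det V).1 hV.isUnit)
  have hW := posDef_add_vecMulVec_self hV x
  have hW1 : (V + Matrix.vecMulVec x x)⁻¹ * (V + Matrix.vecMulVec x x) = 1 :=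
    Matrix.nonsing_inv_mul _ ((Matrix.isUnit_iff_isUnit_det _).1 hW.isUnit)
  set u := V⁻¹ *ᵥ y - (invForm V x y / (1 + invForm V x x)) • (V⁻¹ *ᵥ x) with hu
  have h1 : (V + Matrix.vecMulVec x x) *ᵥ u = y := by
    have h2 : x ⬝ᵥ u = invForm V x y / (1 + invForm V x x) := by
      rw [hu, dotProduct_sub, dotProduct_smul]
      change invForm V x y - _ • invForm V x x = _
      rw [smul_eq_mul]
      field_simp
      ring
    rw [Matrix.add_mulVec, Matrix.vecMulVec_mulVec, op_smul_eq_smul, h2, hu, Matrix.mulVec_sub, Matrix.mulVec_smul,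
      Matrix.mulVec_mulVec, Matrix.mulVec_mulVec, hV1]
    simp
  conv_lhs => rw [← h1]
  rw [Matrix.mulVec_mulVec, hW1, Matrix.one_mulVec]

theorem invForm_add_vecMulVec_self (hV : V.PosDef) (x y : n → ℝ) :
    invForm (V + Matrix.vecMulVec x x) y y =
      invForm V y y - invForm V x y ^ 2 / (1 + invForm V x x) := by
  have : invForm (V + Matrix.vecMulVec x x) y y = invForm V y y -
      invForm V x y / (1 + invForm V x x) * invForm V y x := by
    unfold invForm
    rw [add_vecMulVec_self_inv_mulVec hV, dotProduct_sub, dotProduct_smul]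
    rfl
  rw [this, invForm_comm hV y x]
  ring

/-- If `V ≥ I`, then `V⁻¹ ≤ I`. -/
theorem invForm_self_le (hV : V.PosDef) (h1 : (V - 1).PosSemidef) (x : n → ℝ) :
    invForm V x x ≤ x ⬝ᵥ x := by
  have hV1 : V * V⁻¹ = 1 := Matrix.mul_nonsing_inv _ ((Matrix.isUnit_iff_isUnit_det V).1 hV.isUnit)
  set y := V⁻¹ *ᵥ x with hy
  have hVy : V *ᵥ y = x := by rw [hy, Matrix.mulVec_mulVec, hV1, Matrix.one_mulVec]
  -- With `y = V⁻¹ x`, the hypothesis `V ≥ I` tested on `y` gives `|y|² ≤ x·y`; then `0 ≤ |x - y|² ≤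
  -- |x|² - x·y`.
  have h2 : y ⬝ᵥ y ≤ x ⬝ᵥ y := by
    have := h1.dotProduct_mulVec_nonneg y
    rw [Matrix.sub_mulVec, hVy, Matrix.one_mulVec, star_trivial, dotProduct_sub] at this
    rw [dotProduct_comm x y]
    linarith
  have h3 : 0 ≤ (x - y) ⬝ᵥ (x - y) := by
    simpa using dotProduct_self_star_nonneg (x - y)
  rw [sub_dotProduct, dotProduct_sub, dotProduct_sub, dotProduct_comm y x] at h3
  change x ⬝ᵥ y ≤ _
  linarith

/-- Testing `V - 1` on unit eigenvectors shows that every eigenvalue is at least `1`. -/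
theorem one_le_det (hV : V.PosDef) (h1 : (V - 1).PosSemidef) : 1 ≤ V.det := by
  rw [hV.isHermitian.det_eq_prod_eigenvalues]
  simp only [RCLike.ofReal_real_eq_id, id_eq]
  refine Finset.one_le_prod fun i _ => ?_
  set v := (hV.isHermitian.eigenvectorBasis i).ofLp with hv
  have h2 := h1.dotProduct_mulVec_nonneg v
  have h3 : V *ᵥ v = hV.isHermitian.eigenvalues i • v :=
    hV.isHermitian.mulVec_eigenvectorBasis i
  have h4 : v ⬝ᵥ v = 1 := by
    have h5 := (hV.isHermitian.eigenvectorBasis).orthonormal.1 i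
    rw [EuclideanSpace.norm_eq, Real.sqrt_eq_one] at h5
    simpa [dotProduct, hv, sq] using h5
  rw [Matrix.sub_mulVec, h3, Matrix.one_mulVec, star_trivial, dotProduct_sub, dotProduct_smul,
    h4] at h2
  simpa using h2

/-- The inequality of arithmetic and geometric means for the eigenvalues. -/
theorem log_det_le [Nonempty n] (hV : V.PosDef) :
    Real.log V.det ≤ Fintype.card n * Real.log (V.trace / Fintype.card n) := by
  have hc : (0 : ℝ) < Fintype.card n := by exact_mod_cast Fintype.card_pos
  have hev := fun i => hV.eigenvalues_pos i
  have h := Real.geom_mean_le_arith_mean Finset.univ (fun _ : n => (1 : ℝ))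
    hV.isHermitian.eigenvalues (by simp) (by simpa using hc) (fun i _ => (hev i).le)
  simp only [Real.rpow_one, Finset.sum_const, Finset.card_univ, nsmul_eq_mul, mul_one,
    one_mul] at h
  have hdet : V.det = ∏ i, hV.isHermitian.eigenvalues i := by
    simpa using hV.isHermitian.det_eq_prod_eigenvalues
  have htr : V.trace = ∑ i, hV.isHermitian.eigenvalues i := by
    simpa using hV.isHermitian.trace_eq_sum_eigenvalues
  rw [← hdet, ← htr] at h
  have h2 := Real.log_le_log (Real.rpow_pos_of_pos hV.det_pos _) h
  rw [Real.log_rpow hV.det_pos] at h2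
  calc Real.log V.det = Fintype.card n * ((Fintype.card n : ℝ)⁻¹ * Real.log V.det) := by
        field_simp
    _ ≤ _ := by gcongr

end InverseForm

/-! ### Hoeffding's lemma for a sign and its Gaussian average. -/

section OneDimensional

/-- Hoeffding's lemma for a sign with mean `m`, centred. -/
theorem sign_mgf_le {m : ℝ} (hm : m ∈ Set.Icc (-1 : ℝ) 1) (t : ℝ) :
    (1 + m) / 2 * Real.exp (t * (1 - m)) + (1 - m) / 2 * Real.exp (t * (-1 - m)) ≤
      Real.exp (t ^ 2 / 2) := by
  obtain ⟨h1, h2⟩ := hm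
  have p1 : 0 ≤ (1 + m) / 2 := by linarith
  have p2 : 0 ≤ (1 - m) / 2 := by linarith
  -- The law of the centred sign. Its support lies in an interval of length `2`, so Hoeffding's
  -- variance proxy is `(2 / 2)² = 1`.
  let ν : Measure ℝ := ENNReal.ofReal ((1 + m) / 2) • Measure.dirac (1 - m) +
    ENNReal.ofReal ((1 - m) / 2) • Measure.dirac (-1 - m)
  have hint : ∀ f : ℝ → ℝ, ∫ y, f y ∂ν = (1 + m) / 2 * f (1 - m) + (1 - m) / 2 * f (-1 - m) := by
    intro f
    have hi : ∀ a : ℝ, Integrable f (Measure.dirac a) := fun a => integrable_dirac (by simp)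
    rw [integral_add_measure ((hi _).smul_measure (by simp)) ((hi _).smul_measure (by simp)),
      integral_smul_measure, integral_smul_measure, integral_dirac, integral_dirac,
      ENNReal.toReal_ofReal p1, ENNReal.toReal_ofReal p2]
    rfl
  have : IsProbabilityMeasure ν := by
    constructor
    simp only [ν, Measure.add_apply, Measure.smul_apply, measure_univ, smul_eq_mul, mul_one]
    rw [← ENNReal.ofReal_add p1 p2]
    norm_num
    ring
  have hs : HasSubgaussianMGF (fun y : ℝ => y) ((‖(1 - m) - (-1 - m)‖₊ / 2) ^ 2) ν := by
    refine hasSubgaussianMGF_of_mem_Icc_of_integral_eq_zero aemeasurable_id ?_ ?_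
    · rw [ae_iff]
      simp [ν]
    · rw [hint]
      ring
  have h := hs.mgf_le t
  rw [mgf, hint] at h
  have hc : ((((‖(1 - m) - (-1 - m)‖₊ / 2) ^ 2 : NNReal)) : ℝ) = 1 := by
    have : (1 - m) - (-1 - m) = 2 := by ring
    rw [this]
    simp
  rw [hc, one_mul] at h
  exact h

theorem integrable_exp_quadratic {b : ℝ} (hb : 0 < b) (c : ℝ) :
    Integrable fun g : ℝ => Real.exp (-b * g ^ 2 + c * g) := by
  have h : (fun g : ℝ => Real.exp (-b * g ^ 2 + c * g)) =
      fun g => Real.exp (-b * (g - c / (2 * b)) ^ 2) * Real.exp (c ^ 2 / (4 * b)) := by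
    funext g
    rw [← Real.exp_add]
    congr 1
    field_simp
    ring
  rw [h]
  exact ((integrable_exp_neg_mul_sq hb).comp_sub_right _).mul_const _

theorem integral_exp_quadratic {b : ℝ} (hb : 0 < b) (c : ℝ) :
    ∫ g : ℝ, Real.exp (-b * g ^ 2 + c * g) = √(Real.pi / b) * Real.exp (c ^ 2 / (4 * b)) := by
  have h : (fun g : ℝ => Real.exp (-b * g ^ 2 + c * g)) =
      fun g => Real.exp (-b * (g - c / (2 * b)) ^ 2) * Real.exp (c ^ 2 / (4 * b)) := by
    funext g
    rw [← Real.exp_add]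
    congr 1
    field_simp
    ring
  rw [h, integral_mul_const,
    integral_sub_right_eq_self (fun g : ℝ => Real.exp (-b * g ^ 2)) (c / (2 * b)),
    integral_gaussian]

/-- The Gaussian mixture of Hoeffding's inequality for a centred sign: average `sign_mgf_le`
over `t` normal with mean `z` and variance `q`. -/
theorem sign_mixture_le {m : ℝ} (hm : m ∈ Set.Icc (-1 : ℝ) 1) {q : ℝ} (hq : 0 ≤ q) (z : ℝ) :
    (1 + m) / 2 * Real.exp ((2 * (1 - m) * z + (1 - m) ^ 2 * q - z ^ 2) / (2 * (1 + q))) +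
      (1 - m) / 2 * Real.exp ((2 * (-1 - m) * z + (-1 - m) ^ 2 * q - z ^ 2) / (2 * (1 + q))) ≤
      √(1 + q) := by
  have hb : 0 < (1 + q) / 2 := by linarith
  -- With `g` standard normal, `t = z + √q g` has mean `z` and variance `q`. The Hoeffding bound
  -- `exp(t² / 2)` is moved to the left before averaging, which raises the precision of `g` from `1`
  -- to `1 + q`.
  have key : ∀ ε : ℝ, ∀ g : ℝ, Real.exp ((z + √q * g) * ε - (z + √q * g) ^ 2 / 2 - g ^ 2 / 2) =
      Real.exp (z * ε - z ^ 2 / 2) *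
        Real.exp (-((1 + q) / 2) * g ^ 2 + √q * (ε - z) * g) := by
    intro ε g
    rw [← Real.exp_add]
    congr 1
    have := Real.sq_sqrt hq
    linear_combination (-g ^ 2 / 2) * this
  have hI : ∀ ε : ℝ, Integrable fun g : ℝ =>
      Real.exp ((z + √q * g) * ε - (z + √q * g) ^ 2 / 2 - g ^ 2 / 2) := by
    intro ε
    simp_rw [key ε]
    exact (integrable_exp_quadratic hb _).const_mul _
  have hE : ∀ ε : ℝ, ∫ g : ℝ, Real.exp ((z + √q * g) * ε - (z + √q * g) ^ 2 / 2 - g ^ 2 / 2) =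
      √(Real.pi / ((1 + q) / 2)) *
        Real.exp ((2 * ε * z + ε ^ 2 * q - z ^ 2) / (2 * (1 + q))) := by
    intro ε
    simp_rw [key ε]
    rw [integral_const_mul, integral_exp_quadratic hb, mul_left_comm, ← Real.exp_add]
    congr 2
    rw [mul_pow, Real.sq_sqrt hq]
    field_simp
    ring
  have hI0 := integrable_exp_neg_mul_sq (b := (1 / 2 : ℝ)) (by norm_num)
  have hle : ∫ g : ℝ, ((1 + m) / 2 *
        Real.exp ((z + √q * g) * (1 - m) - (z + √q * g) ^ 2 / 2 - g ^ 2 / 2) +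
      (1 - m) / 2 *
        Real.exp ((z + √q * g) * (-1 - m) - (z + √q * g) ^ 2 / 2 - g ^ 2 / 2)) ≤
      ∫ g : ℝ, Real.exp (-(1 / 2) * g ^ 2) := by
    refine integral_mono (((hI _).const_mul _).add ((hI _).const_mul _)) hI0 fun g => ?_
    have h := sign_mgf_le hm (z + √q * g)
    have h2 := mul_le_mul_of_nonneg_right h
      (Real.exp_pos (-(z + √q * g) ^ 2 / 2 - g ^ 2 / 2)).le
    simp only [add_mul, mul_assoc, ← Real.exp_add] at h2
    convert h2 using 3 <;> ring_nf
  rw [integral_add ((hI _).const_mul _) ((hI _).const_mul _), integral_const_mul,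
    integral_const_mul, hE, hE, integral_gaussian] at hle
  -- The ratio of the two Gaussian normalizations is the factor `√(1 + q)` of the bound.
  have hs : √(Real.pi / (1 / 2)) = √(Real.pi / ((1 + q) / 2)) * √(1 + q) := by
    rw [← Real.sqrt_mul (by positivity)]
    congr 1
    field_simp
  rw [hs] at hle
  have hpos : 0 < √(Real.pi / ((1 + q) / 2)) := Real.sqrt_pos.2 (by positivity)
  refine le_of_mul_le_mul_left (le_trans (le_of_eq ?_) hle) hpos
  ring

end OneDimensional

/-! ### The mixture potential and its one-step inequality. -/

section Potential

variable {n : Type*} [Fintype n] [DecidableEq n] {V : Matrix n n ℝ}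

/-- The Gaussian mixture potential `det(V)^{-1/2} exp (Sᵀ V⁻¹ S / 2)`. -/
def mixPotential (V : Matrix n n ℝ) (S : n → ℝ) : ℝ :=
  Real.exp (invForm V S S / 2) / √V.det

theorem mixPotential_nonneg (V : Matrix n n ℝ) (S : n → ℝ) : 0 ≤ mixPotential V S := by
  unfold mixPotential
  positivity

/-- A crude bound free of `V`; it only serves integrability. -/
theorem mixPotential_le (hV : V.PosDef) (h1 : (V - 1).PosSemidef) (S : n → ℝ) :
    mixPotential V S ≤ Real.exp (S ⬝ᵥ S / 2) := by
  unfold mixPotential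
  have hd : 1 ≤ √V.det := by
    rw [Real.one_le_sqrt]
    exact one_le_det hV h1
  refine (div_le_self (Real.exp_pos _).le hd).trans ?_
  gcongr
  exact invForm_self_le hV h1 S

/-- The update is a scalar factor that depends on `V`, `S` and `x` only through `z = xᵀ V⁻¹ S` and
`q = xᵀ V⁻¹ x`, as in `sign_mixture_le`. -/
theorem mixPotential_add_smul (hV : V.PosDef) (x S : n → ℝ) (ε : ℝ) :
    mixPotential (V + Matrix.vecMulVec x x) (S + ε • x) =
      mixPotential V S * (Real.exp ((2 * ε * invForm V x S + ε ^ 2 * invForm V x x -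
        invForm V x S ^ 2) / (2 * (1 + invForm V x x))) / √(1 + invForm V x x)) := by
  have hq := invForm_self_nonneg hV x
  unfold mixPotential
  rw [det_add_vecMulVec_self hV, Real.sqrt_mul hV.det_pos.le, div_mul_div_comm, ← Real.exp_add,
    invForm_add_vecMulVec_self hV]
  congr 2
  simp only [invForm_add_left, invForm_add_right, invForm_smul_left, invForm_smul_right,
    invForm_comm hV S x]
  field_simp
  ring

/-- One step of the mixture supermartingale. -/
theorem mixPotential_step (hV : V.PosDef) (x S : n → ℝ) {m : ℝ} (hm : m ∈ Set.Icc (-1 : ℝ) 1) :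
    (1 + m) / 2 * mixPotential (V + Matrix.vecMulVec x x) (S + (1 - m) • x) +
      (1 - m) / 2 * mixPotential (V + Matrix.vecMulVec x x) (S + (-1 - m) • x) ≤
      mixPotential V S := by
  have hq := invForm_self_nonneg hV x
  have hs : 0 < √(1 + invForm V x x) := Real.sqrt_pos.2 (by linarith)
  have h := mul_le_mul_of_nonneg_left
    (sign_mixture_le hm hq (invForm V x S)) (mixPotential_nonneg V S)
  rw [mixPotential_add_smul hV, mixPotential_add_smul hV]
  rw [← mul_le_mul_iff_left₀ hs]
  refine le_trans (le_of_eq ?_) h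
  field_simp

end Potential

/-! ### Conditional expectations and the probabilistic content of the protocol. -/

/-- Integrating a bounded `m`-measurable factor against the conditional expectation. -/
theorem integral_mul_eq_of_condExp {Ω : Type*} {m mΩ : MeasurableSpace Ω} {μ : Measure Ω}
    [IsFiniteMeasure μ] (hm : m ≤ mΩ) {f g h : Ω → ℝ} (hf : Measurable[m] f) {B : ℝ}
    (hB : ∀ᵐ ω ∂μ, |f ω| ≤ B) (hg : Integrable g μ) (hgh : μ[g | m] =ᵐ[μ] h) :
    ∫ ω, f ω * g ω ∂μ = ∫ ω, f ω * h ω ∂μ := by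
  have h1 := condExp_stronglyMeasurable_mul_of_bound hm hf.stronglyMeasurable hg B
    (by simpa using hB)
  calc ∫ ω, f ω * g ω ∂μ = ∫ ω, (μ[f * g | m]) ω ∂μ := (integral_condExp hm).symm
    _ = ∫ ω, f ω * h ω ∂μ := by
        refine integral_congr_ae ?_
        filter_upwards [h1, hgh] with ω h2 h3
        rw [h2, Pi.mul_apply, h3]

/-- A bounded function measurable for the pullback of `f` is a bounded measurable function of
`f`, up to a null set. -/
theorem exists_bounded_measurable_comp {Ω E : Type*} {mΩ : MeasurableSpace Ω}
    [mE : MeasurableSpace E] {μ : Measure Ω} {f : Ω → E} {Y : Ω → ℝ}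
    (hY : Measurable[MeasurableSpace.comap f mE] Y) {B : ℝ} (hB : ∀ᵐ ω ∂μ, |Y ω| ≤ B) :
    ∃ g : E → ℝ, Measurable g ∧ (∀ e, |g e| ≤ |B|) ∧ Y =ᵐ[μ] fun ω => g (f ω) := by
  obtain ⟨g, hg, rfl⟩ := hY.exists_eq_measurable_comp
  -- Clipping makes the bound hold everywhere; `|B|` is used because `0 ≤ B` is not assumed.
  refine ⟨fun e => max (-|B|) (min |B| (g e)), by fun_prop, fun e => ?_, ?_⟩
  · rw [abs_le]
    exact ⟨le_max_left _ _, max_le (by linarith [abs_nonneg B]) (min_le_left _ _)⟩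
  · filter_upwards [hB] with ω h
    have h2 := abs_le.1 (h.trans (le_abs_self B))
    simp only [Function.comp_apply] at h2 ⊢
    rw [min_eq_right h2.2, max_eq_right h2.1]

theorem measurable_pair_apply (K : ℕ) (E : Type*) [MeasurableSpace E] :
    Measurable fun z : (Fin K → Fin K → E) × Fin K × Fin K => z.1 z.2.1 z.2.2 := by
  refine measurable_from_prod_countable_left fun y => ?_
  exact (measurable_pi_apply y.2).comp (measurable_pi_apply y.1)

theorem measurable_linPref {K d : ℕ} (w : Fin d → ℝ) (a b : Fin K) :
    Measurable fun x : Context K d => linPref w x a b := by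
  unfold linPref dotProduct
  fun_prop

theorem measurable_linPref_apply {K d : ℕ} (w : Fin d → ℝ) :
    Measurable fun z : Context K d × Fin K × Fin K => linPref w z.1 z.2.1 z.2.2 := by
  refine measurable_from_prod_countable_left fun y => ?_
  exact measurable_linPref w y.1 y.2

namespace IsLinDB

variable {K d : ℕ} {X : Set (Context K d)} {D : Measure (Context K d × PairMatrix K)}
  {w : Fin d → ℝ}

theorem integrable_pref (h : IsLinDB X D w) (i j : Fin K) : Integrable (fun z => z.2 i j) D := by
  have := h.prob
  refine Integrable.of_bound (by fun_prop) 1 ?_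
  filter_upwards [h.pref_mem] with z hz
  exact abs_le.2 (hz i j)

theorem linPref_bounded (h : IsLinDB X D w) : ∀ᵐ z ∂D, Bounded (linPref w z.1) := by
  filter_upwards [h.context_mem] with z hz
  exact h.param_mem.2 _ hz

theorem integrable_linPref (h : IsLinDB X D w) (i j : Fin K) :
    Integrable (fun z => linPref w z.1 i j) D := by
  have := h.prob
  refine Integrable.of_bound
    ((measurable_linPref w i j).comp measurable_fst).aestronglyMeasurable 1 ?_
  filter_upwards [h.linPref_bounded] with z hz
  exact abs_le.2 (hz i j)

theorem integral_mul_pref (h : IsLinDB X D w) {f : Context K d → ℝ} (hf : Measurable f) {B : ℝ}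
    (hB : ∀ x, |f x| ≤ B) (i j : Fin K) :
    ∫ z, f z.1 * z.2 i j ∂D = ∫ z, f z.1 * linPref w z.1 i j ∂D := by
  have := h.prob
  exact integral_mul_eq_of_condExp (f := fun z : Context K d × PairMatrix K => f z.1)
    measurable_fst.comap_le (hf.comp (comap_measurable Prod.fst))
    (ae_of_all _ fun z => hB _) (h.integrable_pref i j) (h.realizable i j)

end IsLinDB

namespace Interaction

variable {Ω : Type*} {K d : ℕ} (S : Interaction Ω K d)

/-- The past and the current context. -/
abbrev contextInfo (t : ℕ) : MeasurableSpace Ω :=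
  MeasurableSpace.comap (fun ω => (S.past t ω, S.x t ω)) inferInstance

/-- The past, the current context and the current duel. -/
abbrev duelInfo (t : ℕ) : MeasurableSpace Ω :=
  MeasurableSpace.comap (fun ω => (S.past t ω, S.x t ω, S.a t ω, S.b t ω)) inferInstance

theorem learnerInfo_le (t : ℕ) : S.learnerInfo t ≤ S.contextInfo t := by
  have h : Measurable fun z : (Fin t → Context K d × PairMatrix K × Fin K × Fin K × ℝ) ×
      Context K d => ((fun s => ((z.1 s).1, (z.1 s).2.2)), z.2) := by fun_prop
  exact (h.comp (comap_measurable fun ω => (S.past t ω, S.x t ω))).comap_le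

theorem contextInfo_le_duelInfo (t : ℕ) : S.contextInfo t ≤ S.duelInfo t := by
  have h : Measurable fun z : (Fin t → Context K d × PairMatrix K × Fin K × Fin K × ℝ) ×
      Context K d × Fin K × Fin K => (z.1, z.2.1) := by fun_prop
  exact (h.comp
    (comap_measurable fun ω => (S.past t ω, S.x t ω, S.a t ω, S.b t ω))).comap_le

theorem contextInfo_le_preDuel (t : ℕ) : S.contextInfo t ≤ S.preDuel t := by
  have h : Measurable fun z : (Fin t → Context K d × PairMatrix K × Fin K × Fin K × ℝ) ×
      Context K d × PairMatrix K => (z.1, z.2.1) := by fun_prop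
  exact (h.comp (comap_measurable fun ω => (S.past t ω, S.x t ω, S.P t ω))).comap_le

theorem duelInfo_le_preOutcome (t : ℕ) : S.duelInfo t ≤ S.preOutcome t := by
  have h : Measurable fun z : (Fin t → Context K d × PairMatrix K × Fin K × Fin K × ℝ) ×
      Context K d × PairMatrix K × Fin K × Fin K => (z.1, z.2.1, z.2.2.2) := by fun_prop
  exact (h.comp
    (comap_measurable fun ω => (S.past t ω, S.x t ω, S.P t ω, S.a t ω, S.b t ω))).comap_le

namespace IsDuelingBandit

variable {S} [mΩ : MeasurableSpace Ω] {μ : Measure Ω} [IsProbabilityMeasure μ] {T t : ℕ}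
  {X : Set (Context K d)} {D : Measure (Context K d × PairMatrix K)} {w : Fin d → ℝ}

omit [IsProbabilityMeasure μ] in
theorem measurable_past (hS : S.IsDuelingBandit μ T D) (ht : t ≤ T) : Measurable (S.past t) := by
  refine measurable_pi_lambda _ fun s => ?_
  have hs := s.2.trans_le ht
  exact (hS.measurable_x _ hs).prodMk ((hS.measurable_P _ hs).prodMk ((hS.measurable_a _ hs).prodMk
    ((hS.measurable_b _ hs).prodMk (hS.measurable_o _ hs))))

omit [IsProbabilityMeasure μ] in
theorem preDuel_le (hS : S.IsDuelingBandit μ T D) (ht : t < T) : S.preDuel t ≤ mΩ :=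
  ((hS.measurable_past ht.le).prodMk ((hS.measurable_x t ht).prodMk
    (hS.measurable_P t ht))).comap_le

omit [IsProbabilityMeasure μ] in
theorem preOutcome_le (hS : S.IsDuelingBandit μ T D) (ht : t < T) : S.preOutcome t ≤ mΩ :=
  ((hS.measurable_past ht.le).prodMk ((hS.measurable_x t ht).prodMk
    ((hS.measurable_P t ht).prodMk ((hS.measurable_a t ht).prodMk
      (hS.measurable_b t ht))))).comap_le

omit [IsProbabilityMeasure μ] in
theorem ae_of_law (hS : S.IsDuelingBandit μ T D) (ht : t < T)
    {p : Context K d × PairMatrix K → Prop} (hp : ∀ᵐ z ∂D, p z) :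
    ∀ᵐ ω ∂μ, p (S.x t ω, S.P t ω) := by
  rw [← hS.law t ht] at hp
  exact ae_of_ae_map ((hS.measurable_x t ht).prodMk (hS.measurable_P t ht)).aemeasurable hp

/-- Realizability in round `t`, for weights that depend on the past and the context. -/
theorem integral_mul_pref (hS : S.IsDuelingBandit μ T D) (hD : IsLinDB X D w) (ht : t < T)
    {Y : Ω → ℝ} (hY : Measurable[S.contextInfo t] Y) {B : ℝ} (hB : ∀ᵐ ω ∂μ, |Y ω| ≤ B)
    (i j : Fin K) :
    ∫ ω, Y ω * S.P t ω i j ∂μ = ∫ ω, Y ω * linPref w (S.x t ω) i j ∂μ := by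
  have := hD.prob
  obtain ⟨g, hg, hgB, hYg⟩ := exists_bounded_measurable_comp hY hB
  have mpast := hS.measurable_past ht.le
  have mz := (hS.measurable_x t ht).prodMk (hS.measurable_P t ht)
  have := Measure.isProbabilityMeasure_map (μ := μ) mpast.aemeasurable
  have hmap := (indepFun_iff_map_prod_eq_prod_map_map mpast.aemeasurable mz.aemeasurable).1
    (hS.indep t ht)
  rw [hS.law t ht] at hmap
  -- By independence the past can be frozen at `u`; the weight is then a function of the context
  -- alone, and realizability under `D` applies.
  have key : ∀ Q : Context K d × PairMatrix K → ℝ, Measurable Q → Integrable Q D →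
      ∫ ω, Y ω * Q (S.x t ω, S.P t ω) ∂μ =
        ∫ u, ∫ z, g (u, z.1) * Q z ∂D ∂(μ.map (S.past t)) := by
    intro Q mQ hQ
    have mG : Measurable fun v : (Fin t → Context K d × PairMatrix K × Fin K × Fin K × ℝ) ×
        (Context K d × PairMatrix K) => g (v.1, v.2.1) * Q v.2 := by fun_prop
    have hQ' : Integrable (fun v : (Fin t → Context K d × PairMatrix K × Fin K × Fin K × ℝ) ×
        (Context K d × PairMatrix K) => g (v.1, v.2.1) * Q v.2) ((μ.map (S.past t)).prod D) := by
      refine Integrable.bdd_mul (c := |B|) (hQ.comp_snd _)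
        (hg.comp (by fun_prop)).aestronglyMeasurable ?_
      exact ae_of_all _ fun v => hgB _
    rw [← integral_prod _ hQ', ← hmap, integral_map (mpast.prodMk mz).aemeasurable
      mG.aestronglyMeasurable]
    refine integral_congr_ae ?_
    filter_upwards [hYg] with ω h
    rw [h]
  rw [key (fun z => z.2 i j) (by fun_prop) (hD.integrable_pref i j),
    key (fun z => linPref w z.1 i j) ((measurable_linPref w i j).comp measurable_fst)
      (hD.integrable_linPref i j)]
  refine integral_congr_ae (ae_of_all _ fun u => ?_)
  exact hD.integral_mul_pref (f := fun x => g (u, x)) (by fun_prop) (fun x => hgB _) i j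

omit [IsProbabilityMeasure μ] in
theorem measurable_p (hS : S.IsDuelingBandit μ T D) (ht : t < T) (i j : Fin K) :
    Measurable[S.contextInfo t] fun ω => S.p t ω i j :=
  (measurable_pi_apply j).comp ((measurable_pi_apply i).comp
    ((hS.adapted t ht).mono (S.learnerInfo_le t) le_rfl))

omit [IsProbabilityMeasure μ] in
theorem measurable_p' (hS : S.IsDuelingBandit μ T D) (ht : t < T) (i j : Fin K) :
    Measurable fun ω => S.p t ω i j :=
  (hS.measurable_p ht i j).mono ((S.contextInfo_le_preDuel t).trans (hS.preDuel_le ht)) le_rfl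

omit [IsProbabilityMeasure μ] in
theorem p_mem_Icc (hS : S.IsDuelingBandit μ T D) (ht : t < T) (i j : Fin K) :
    ∀ᵐ ω ∂μ, S.p t ω i j ∈ Set.Icc (0 : ℝ) 1 := by
  filter_upwards [hS.dist t ht] with ω h
  refine ⟨h.1 i j, ?_⟩
  rw [← h.2]
  refine (Finset.single_le_sum (fun b _ => h.1 i b) (Finset.mem_univ j)).trans ?_
  exact Finset.single_le_sum (f := fun a => ∑ b, S.p t ω a b)
    (fun a _ => Finset.sum_nonneg fun b _ => h.1 a b) (Finset.mem_univ i)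

/-- The duel of round `t` has conditional law `p t`. -/
theorem integral_duel (hS : S.IsDuelingBandit μ T D) (ht : t < T)
    {h : Fin K → Fin K → Ω → ℝ} (hm : ∀ i j, Measurable[S.preDuel t] (h i j))
    {B : ℝ} (hB : ∀ i j, ∀ᵐ ω ∂μ, |h i j ω| ≤ B) :
    ∫ ω, h (S.a t ω) (S.b t ω) ω ∂μ = ∑ i, ∑ j, ∫ ω, h i j ω * S.p t ω i j ∂μ := by
  have hle := hS.preDuel_le ht
  have ms : ∀ i j, MeasurableSet {ω | S.a t ω = i ∧ S.b t ω = j} := fun i j =>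
    (hS.measurable_a t ht (measurableSet_singleton i)).inter
      (hS.measurable_b t ht (measurableSet_singleton j))
  have hi : ∀ i j, Integrable ({ω | S.a t ω = i ∧ S.b t ω = j}.indicator fun _ => (1 : ℝ)) μ :=
    fun i j => (integrable_const 1).indicator (ms i j)
  have hint : ∀ i j, Integrable (fun ω => h i j ω *
      {ω | S.a t ω = i ∧ S.b t ω = j}.indicator (fun _ => (1 : ℝ)) ω) μ := fun i j =>
    (hi i j).bdd_mul (c := B) ((hm i j).mono hle le_rfl).aestronglyMeasurable (hB i j)
  calc ∫ ω, h (S.a t ω) (S.b t ω) ω ∂μ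
      = ∫ ω, ∑ i, ∑ j, h i j ω *
        {ω | S.a t ω = i ∧ S.b t ω = j}.indicator (fun _ => (1 : ℝ)) ω ∂μ := by
        congr 1
        funext ω
        rw [Finset.sum_eq_single (S.a t ω), Finset.sum_eq_single (S.b t ω)]
        · simp
        · intro j _ hj
          simp [hj.symm]
        · simp
        · intro i _ hi
          simp [hi.symm]
        · simp
    _ = ∑ i, ∑ j, ∫ ω, h i j ω *
        {ω | S.a t ω = i ∧ S.b t ω = j}.indicator (fun _ => (1 : ℝ)) ω ∂μ := by
        rw [integral_finsetSum _ fun i _ => integrable_finsetSum _ fun j _ => hint i j]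
        refine Finset.sum_congr rfl fun i _ => ?_
        rw [integral_finsetSum _ fun j _ => hint i j]
    _ = _ := by
        refine Finset.sum_congr rfl fun i _ => Finset.sum_congr rfl fun j _ => ?_
        exact integral_mul_eq_of_condExp hle (hm i j) (hB i j) (hi i j) (hS.duel t ht i j)

/-- The outcome has conditional mean `P t [a t, b t]` before it is drawn. -/
theorem integral_mul_outcome (hS : S.IsDuelingBandit μ T D) (hD : IsLinDB X D w) (ht : t < T)
    {Y : Ω → ℝ} (hY : Measurable[S.preOutcome t] Y) {B : ℝ} (hB : ∀ᵐ ω ∂μ, |Y ω| ≤ B) :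
    ∫ ω, Y ω * S.o t ω ∂μ = ∫ ω, Y ω * S.P t ω (S.a t ω) (S.b t ω) ∂μ := by
  have hle := hS.preOutcome_le ht
  have ms : MeasurableSet {ω | S.o t ω = 1} := hS.measurable_o t ht (measurableSet_singleton 1)
  have hi : Integrable ({ω | S.o t ω = 1}.indicator fun _ => (1 : ℝ)) μ :=
    (integrable_const 1).indicator ms
  have mY : Measurable Y := hY.mono hle le_rfl
  have iY : Integrable Y μ := Integrable.of_bound mY.aestronglyMeasurable B (by simpa using hB)
  have mP : Measurable fun ω => S.P t ω (S.a t ω) (S.b t ω) :=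
    (measurable_pair_apply K ℝ).comp ((hS.measurable_P t ht).prodMk
      ((hS.measurable_a t ht).prodMk (hS.measurable_b t ht)))
  have iP : Integrable (fun ω => Y ω * S.P t ω (S.a t ω) (S.b t ω)) μ := by
    refine iY.mul_bdd (c := 1) mP.aestronglyMeasurable ?_
    filter_upwards [hS.ae_of_law ht hD.pref_mem] with ω h
    exact abs_le.2 (h _ _)
  have h1 := integral_mul_eq_of_condExp hle hY hB hi (hS.outcome t ht)
  -- A sign satisfies `o = 2 · 1{o = 1} - 1`.
  have e1 : ∫ ω, Y ω * S.o t ω ∂μ =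
      2 * ∫ ω, Y ω * {ω | S.o t ω = 1}.indicator (fun _ => (1 : ℝ)) ω ∂μ - ∫ ω, Y ω ∂μ := by
    rw [← integral_const_mul, ← integral_sub ((hi.bdd_mul (c := B)
      mY.aestronglyMeasurable hB).const_mul 2) iY]
    refine integral_congr_ae ?_
    filter_upwards [hS.outcome_mem t ht] with ω h
    rcases h with h | h
    · simp [h]
      ring
    · have : (-1 : ℝ) ≠ 1 := by norm_num
      simp [h, this]
  have e2 : ∫ ω, Y ω * ((S.P t ω (S.a t ω) (S.b t ω) + 1) / 2) ∂μ =
      (∫ ω, Y ω * S.P t ω (S.a t ω) (S.b t ω) ∂μ + ∫ ω, Y ω ∂μ) / 2 := by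
    rw [← integral_add iP iY, ← integral_div]
    congr 1
    funext ω
    ring
  rw [e1, h1, e2]
  ring

/-- Given the past, the context and the duel, the outcome has conditional mean
`f_w (x t) [a t, b t]`. -/
theorem integral_mul_outcome_linPref (hS : S.IsDuelingBandit μ T D) (hD : IsLinDB X D w)
    (ht : t < T) {Y : Ω → ℝ} (hY : Measurable[S.duelInfo t] Y) {B : ℝ}
    (hB : ∀ᵐ ω ∂μ, |Y ω| ≤ B) :
    ∫ ω, Y ω * S.o t ω ∂μ = ∫ ω, Y ω * linPref w (S.x t ω) (S.a t ω) (S.b t ω) ∂μ := by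
  rw [hS.integral_mul_outcome hD ht (hY.mono (S.duelInfo_le_preOutcome t) le_rfl) hB]
  obtain ⟨g, hg, hgB, hYg⟩ := exists_bounded_measurable_comp hY hB
  have mg : ∀ i j, Measurable[S.contextInfo t] fun ω => g (S.past t ω, S.x t ω, i, j) := by
    intro i j
    have : Measurable fun z : (Fin t → Context K d × PairMatrix K × Fin K × Fin K × ℝ) ×
        Context K d => g (z.1, z.2, i, j) := by fun_prop
    exact this.comp (comap_measurable fun ω => (S.past t ω, S.x t ω))
  have mP : ∀ i j, Measurable[S.preDuel t] fun ω => S.P t ω i j := by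
    intro i j
    have : Measurable fun z : (Fin t → Context K d × PairMatrix K × Fin K × Fin K × ℝ) ×
        Context K d × PairMatrix K => z.2.2 i j := by fun_prop
    exact this.comp (comap_measurable fun ω => (S.past t ω, S.x t ω, S.P t ω))
  have mL : ∀ i j, Measurable[S.preDuel t] fun ω => linPref w (S.x t ω) i j := by
    intro i j
    have : Measurable fun z : (Fin t → Context K d × PairMatrix K × Fin K × Fin K × ℝ) ×
        Context K d × PairMatrix K => linPref w z.2.1 i j :=
      (measurable_linPref w i j).comp (by fun_prop)
    exact this.comp (comap_measurable fun ω => (S.past t ω, S.x t ω, S.P t ω))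
  have hb : ∀ (i j : Fin K) (r : Ω → ℝ), (∀ᵐ ω ∂μ, r ω ∈ Set.Icc (-1 : ℝ) 1) →
      ∀ᵐ ω ∂μ, |g (S.past t ω, S.x t ω, i, j) * r ω| ≤ |B| := by
    intro i j r hr
    filter_upwards [hr] with ω h
    rw [abs_mul]
    exact (mul_le_of_le_one_right (abs_nonneg _) (abs_le.2 h)).trans (hgB _)
  have bP : ∀ i j, ∀ᵐ ω ∂μ, S.P t ω i j ∈ Set.Icc (-1 : ℝ) 1 := fun i j => by
    filter_upwards [hS.ae_of_law ht hD.pref_mem] with ω h using h i j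
  have bL : ∀ i j, ∀ᵐ ω ∂μ, linPref w (S.x t ω) i j ∈ Set.Icc (-1 : ℝ) 1 := fun i j => by
    filter_upwards [hS.ae_of_law ht hD.linPref_bounded] with ω h using h i j
  have mg' := fun i j => (mg i j).mono (S.contextInfo_le_preDuel t) le_rfl
  have e1 := hS.integral_duel ht
    (h := fun i j ω => g (S.past t ω, S.x t ω, i, j) * S.P t ω i j)
    (fun i j => (mg' i j).mul (mP i j)) (fun i j => hb i j _ (bP i j))
  have e2 := hS.integral_duel ht
    (h := fun i j ω => g (S.past t ω, S.x t ω, i, j) * linPref w (S.x t ω) i j)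
    (fun i j => (mg' i j).mul (mL i j)) (fun i j => hb i j _ (bL i j))
  -- Once the pair is fixed, the weight times `p t i j` depends on the past and the context only,
  -- since the learner does not see `P t`; so `P t` may be replaced by its conditional mean.
  have e3 : ∀ i j, ∫ ω, g (S.past t ω, S.x t ω, i, j) * S.P t ω i j * S.p t ω i j ∂μ =
      ∫ ω, g (S.past t ω, S.x t ω, i, j) * linPref w (S.x t ω) i j * S.p t ω i j ∂μ := by
    intro i j
    have hp : ∀ᵐ ω ∂μ, S.p t ω i j ∈ Set.Icc (-1 : ℝ) 1 := by
      filter_upwards [hS.p_mem_Icc ht i j] with ω h using ⟨by linarith [h.1], h.2⟩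
    have := hS.integral_mul_pref hD ht ((mg i j).mul (hS.measurable_p ht i j))
      (hb i j _ hp) i j
    simpa only [Pi.mul_apply, mul_right_comm] using this
  have c1 : ∫ ω, Y ω * S.P t ω (S.a t ω) (S.b t ω) ∂μ =
      ∫ ω, g (S.past t ω, S.x t ω, S.a t ω, S.b t ω) * S.P t ω (S.a t ω) (S.b t ω) ∂μ :=
    integral_congr_ae (by filter_upwards [hYg] with ω h; rw [h])
  have c2 : ∫ ω, Y ω * linPref w (S.x t ω) (S.a t ω) (S.b t ω) ∂μ =
      ∫ ω, g (S.past t ω, S.x t ω, S.a t ω, S.b t ω) *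
        linPref w (S.x t ω) (S.a t ω) (S.b t ω) ∂μ :=
    integral_congr_ae (by filter_upwards [hYg] with ω h; rw [h])
  rw [c1, c2, e1, e2]
  simp only [e3]

end IsDuelingBandit

end Interaction

/-! ### Measurability of determinants, inverses and potentials. -/

section Measurability

variable {Ω n : Type*} [Fintype n] [DecidableEq n] {m : MeasurableSpace Ω}

theorem measurable_det {V : Ω → Matrix n n ℝ} (hV : ∀ i j, Measurable fun ω => V ω i j) :
    Measurable fun ω => (V ω).det := by
  simp only [Matrix.det_apply]
  fun_prop

theorem measurable_adjugate {V : Ω → Matrix n n ℝ} (hV : ∀ i j, Measurable fun ω => V ω i j)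
    (i j : n) : Measurable fun ω => (V ω).adjugate i j := by
  simp only [Matrix.adjugate_apply]
  refine measurable_det fun k l => ?_
  simp only [Matrix.updateRow_apply]
  split_ifs
  · exact measurable_const
  · exact hV k l

/-- By Cramer's rule the inverse is the adjugate divided by the determinant. -/
theorem measurable_invForm {V : Ω → Matrix n n ℝ} (hV : ∀ i j, Measurable fun ω => V ω i j)
    {x y : Ω → n → ℝ} (hx : Measurable x) (hy : Measurable y) :
    Measurable fun ω => invForm (V ω) (x ω) (y ω) := by
  have h1 := measurable_det hV
  have h2 := measurable_adjugate hV
  simp only [invForm, Matrix.inv_def, Ring.inverse_eq_inv, dotProduct, Matrix.mulVec,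
    Matrix.smul_apply, smul_eq_mul]
  fun_prop

theorem measurable_mixPotential {V : Ω → Matrix n n ℝ} (hV : ∀ i j, Measurable fun ω => V ω i j)
    {x : Ω → n → ℝ} (hx : Measurable x) : Measurable fun ω => mixPotential (V ω) (x ω) := by
  have h1 := measurable_det hV
  have h2 := measurable_invForm hV hx hx
  unfold mixPotential
  fun_prop

end Measurability

theorem dotProduct_self_le {d : ℕ} {u : Fin d → ℝ} {c : ℝ} (hu : ∀ i, |u i| ≤ c) :
    u ⬝ᵥ u ≤ d * c ^ 2 := by
  have : u ⬝ᵥ u ≤ ∑ _i : Fin d, c ^ 2 := by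
    refine Finset.sum_le_sum fun i _ => ?_
    rw [← sq, ← sq_abs]
    exact pow_le_pow_left₀ (abs_nonneg _) (hu i) 2
  simpa using this

/-! ### The self-normalized supermartingale of the noise. -/

namespace Interaction

variable {Ω : Type*} {K d : ℕ} (S : Interaction Ω K d)

/-- The feature vector of the duel of round `t`. -/
def feature (t : ℕ) (ω : Ω) : Fin d → ℝ := S.x t ω (S.a t ω) (S.b t ω)

/-- The mean outcome of the duel of round `t`. -/
def meanOutcome (w : Fin d → ℝ) (t : ℕ) (ω : Ω) : ℝ :=
  linPref w (S.x t ω) (S.a t ω) (S.b t ω)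

/-- The sum of the features before round `t`, weighted by the noise of the outcomes. -/
def noiseSum (w : Fin d → ℝ) (t : ℕ) (ω : Ω) : Fin d → ℝ :=
  ∑ s ∈ Finset.range t, (S.o s ω - S.meanOutcome w s ω) • S.feature s ω

theorem gram_zero (ω : Ω) : S.gram 1 0 ω = 1 := by simp [gram]

theorem gram_succ (lam : ℝ) (t : ℕ) (ω : Ω) : S.gram lam (t + 1) ω =
    S.gram lam t ω + Matrix.vecMulVec (S.feature t ω) (S.feature t ω) := by
  simp [gram, Finset.sum_range_succ, feature, add_assoc]

theorem gram_sub_one_posSemidef (t : ℕ) (ω : Ω) : (S.gram 1 t ω - 1).PosSemidef := by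
  rw [gram, one_smul, add_sub_cancel_left]
  refine Matrix.posSemidef_sum _ fun s _ => ?_
  simpa using Matrix.posSemidef_vecMulVec_self_star (S.x s ω (S.a s ω) (S.b s ω))

theorem gram_posDef (t : ℕ) (ω : Ω) : (S.gram 1 t ω).PosDef := by
  have := Matrix.PosDef.one.add_posSemidef (S.gram_sub_one_posSemidef t ω)
  rwa [add_sub_cancel] at this

theorem trace_gram_le {t : ℕ} {ω : Ω} (h : ∀ s < t, ∀ i, |S.feature s ω i| ≤ 1) :
    (S.gram 1 t ω).trace ≤ d * (1 + t) := by
  rw [gram, Matrix.trace_add, Matrix.trace_sum, one_smul, Matrix.trace_one, Fintype.card_fin]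
  have : ∑ s ∈ Finset.range t, (Matrix.vecMulVec (S.feature s ω) (S.feature s ω)).trace ≤
      ∑ s ∈ Finset.range t, (d : ℝ) := by
    refine Finset.sum_le_sum fun s hs => ?_
    rw [Matrix.trace_vecMulVec]
    simpa using dotProduct_self_le (h s (Finset.mem_range.1 hs))
  simp only [Finset.sum_const, Finset.card_range, nsmul_eq_mul] at this
  unfold feature at this
  linarith

/-- By `trace_gram_le` the mean eigenvalue is at most `1 + t`, so the determinant is at most `(1 +
t)^d`. -/
theorem log_det_gram_le {t : ℕ} {ω : Ω} (h : ∀ s < t, ∀ i, |S.feature s ω i| ≤ 1) :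
    Real.log (S.gram 1 t ω).det ≤ d * Real.log (1 + t) := by
  rcases Nat.eq_zero_or_pos d with rfl | hd
  · simp
  have : Nonempty (Fin d) := ⟨⟨0, hd⟩⟩
  have hd' : (0 : ℝ) < d := by exact_mod_cast hd
  have h1 := log_det_le (S.gram_posDef t ω)
  rw [Fintype.card_fin] at h1
  refine h1.trans ?_
  have h2 := (S.gram_posDef t ω).trace_pos
  gcongr
  rw [div_le_iff₀ hd', mul_comm]
  exact S.trace_gram_le h

theorem noiseSum_succ (w : Fin d → ℝ) (t : ℕ) (ω : Ω) : S.noiseSum w (t + 1) ω =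
    S.noiseSum w t ω + (S.o t ω - S.meanOutcome w t ω) • S.feature t ω := by
  simp [noiseSum, Finset.sum_range_succ]

/-- The self-normalized mixture process, a supermartingale started at `1`. -/
def mixSupermart (w : Fin d → ℝ) (t : ℕ) (ω : Ω) : ℝ :=
  mixPotential (S.gram 1 t ω) (S.noiseSum w t ω)

theorem mixSupermart_nonneg (w : Fin d → ℝ) (t : ℕ) (ω : Ω) : 0 ≤ S.mixSupermart w t ω :=
  mixPotential_nonneg _ _

/-- The almost sure properties of the contexts and outcomes of the first `T` rounds. -/
def IsRegular (X : Set (Context K d)) (T : ℕ) (ω : Ω) : Prop :=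
  ∀ s < T, S.x s ω ∈ X ∧ (S.o s ω = 1 ∨ S.o s ω = -1)

section Regular

variable {S} {X : Set (Context K d)} {D : Measure (Context K d × PairMatrix K)}
  {w : Fin d → ℝ} {T s t : ℕ} {ω : Ω}

theorem IsRegular.abs_feature_le (h : S.IsRegular X T ω) (hD : IsLinDB X D w) (hs : s < T)
    (i : Fin d) : |S.feature s ω i| ≤ 1 :=
  abs_le.2 (hD.feature_mem _ (h s hs).1 _ _ i)

theorem IsRegular.meanOutcome_mem (h : S.IsRegular X T ω) (hD : IsLinDB X D w) (hs : s < T) :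
    S.meanOutcome w s ω ∈ Set.Icc (-1 : ℝ) 1 :=
  hD.param_mem.2 _ (h s hs).1 _ _

theorem abs_sub_mul_le {o m f : ℝ} (ho : o = 1 ∨ o = -1) (hm : m ∈ Set.Icc (-1 : ℝ) 1)
    (hf : |f| ≤ 1) : |(o - m) * f| ≤ 2 := by
  have h1 : |o - m| ≤ 2 := by
    obtain ⟨h1, h2⟩ := hm
    rcases ho with rfl | rfl <;> rw [abs_le] <;> constructor <;> linarith
  rw [abs_mul]
  nlinarith [abs_nonneg (o - m), abs_nonneg f]

theorem IsRegular.abs_noiseSum_le (h : S.IsRegular X T ω) (hD : IsLinDB X D w) (ht : t ≤ T)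
    (i : Fin d) : |S.noiseSum w t ω i| ≤ 2 * t := by
  induction t with
  | zero => simp [noiseSum]
  | succ t ih =>
    rw [noiseSum_succ, Pi.add_apply, Pi.smul_apply, smul_eq_mul]
    have h1 := ih (by omega)
    have h2 := abs_sub_mul_le (h t ht).2 (h.meanOutcome_mem hD ht) (h.abs_feature_le hD ht i)
    refine (abs_add_le _ _).trans ?_
    push_cast
    linarith

/-- Stated for either sign `o`, including the one not observed, because the slope in
`mixSupermart_succ_le` involves both. -/
theorem IsRegular.mixPotential_le (h : S.IsRegular X T ω) (hD : IsLinDB X D w) (ht : t < T)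
    {o : ℝ} (ho : o = 1 ∨ o = -1) :
    mixPotential (S.gram 1 (t + 1) ω)
      (S.noiseSum w t ω + (o - S.meanOutcome w t ω) • S.feature t ω) ≤
      Real.exp (d * (2 * t + 2) ^ 2 / 2) := by
  refine (DuelingBandit.mixPotential_le (S.gram_posDef _ _) (S.gram_sub_one_posSemidef _ _)
    _).trans ?_
  gcongr
  refine dotProduct_self_le fun i => ?_
  rw [Pi.add_apply, Pi.smul_apply, smul_eq_mul]
  refine (abs_add_le _ _).trans ?_
  exact add_le_add (h.abs_noiseSum_le hD ht.le i)
    (abs_sub_mul_le ho (h.meanOutcome_mem hD ht) (h.abs_feature_le hD ht i))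

theorem IsRegular.mixSupermart_le (h : S.IsRegular X T ω) (hD : IsLinDB X D w) (ht : t ≤ T) :
    S.mixSupermart w t ω ≤ Real.exp (d * (2 * t) ^ 2 / 2) := by
  refine (DuelingBandit.mixPotential_le (S.gram_posDef _ _) (S.gram_sub_one_posSemidef _ _)
    _).trans ?_
  gcongr
  exact dotProduct_self_le fun i => h.abs_noiseSum_le hD ht i

/-- The effect on the mixture process of a sign outcome is affine in the outcome. -/
theorem IsRegular.mixSupermart_succ_le (h : S.IsRegular X T ω) (hD : IsLinDB X D w) (ht : t < T) :
    S.mixSupermart w (t + 1) ω ≤ S.mixSupermart w t ω +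
      (mixPotential (S.gram 1 (t + 1) ω)
          (S.noiseSum w t ω + (1 - S.meanOutcome w t ω) • S.feature t ω) -
        mixPotential (S.gram 1 (t + 1) ω)
          (S.noiseSum w t ω + (-1 - S.meanOutcome w t ω) • S.feature t ω)) / 2 *
        (S.o t ω - S.meanOutcome w t ω) := by
  -- On signs the new value is an affine function of the outcome; `mixPotential_step` bounds its
  -- value at the mean outcome, and the rest is slope times noise.
  have hstep := mixPotential_step (S.gram_posDef t ω) (S.feature t ω) (S.noiseSum w t ω)
    (h.meanOutcome_mem hD ht)
  rw [← gram_succ] at hstep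
  unfold mixSupermart
  rw [noiseSum_succ]
  rcases (h t ht).2 with ho | ho <;> rw [ho] <;> linarith

end Regular

section Measurability

variable {S} {t : ℕ} {m : MeasurableSpace Ω}

theorem measurable_gram (h : ∀ s < t, Measurable (S.feature s)) (lam : ℝ) (i j : Fin d) :
    Measurable fun ω => S.gram lam t ω i j := by
  simp only [gram, Matrix.add_apply, Matrix.sum_apply, Matrix.vecMulVec_apply]
  refine measurable_const.add (Finset.measurable_fun_sum _ fun s hs => ?_)
  have := h s (Finset.mem_range.1 hs)
  exact ((measurable_pi_apply i).comp this).mul ((measurable_pi_apply j).comp this)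

theorem measurable_noiseSum {w : Fin d → ℝ} (h : ∀ s < t, Measurable (S.feature s))
    (ho : ∀ s < t, Measurable (S.o s)) (hm : ∀ s < t, Measurable (S.meanOutcome w s)) :
    Measurable (S.noiseSum w t) := by
  unfold noiseSum
  refine Finset.measurable_fun_sum _ fun s hs => ?_
  have hs := Finset.mem_range.1 hs
  exact ((ho s hs).sub (hm s hs)).smul (h s hs)

theorem measurable_feature (hx : Measurable (S.x t)) (ha : Measurable (S.a t))
    (hb : Measurable (S.b t)) : Measurable (S.feature t) :=
  (measurable_pair_apply K (Fin d → ℝ)).comp (hx.prodMk (ha.prodMk hb))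

theorem measurable_meanOutcome (w : Fin d → ℝ) (hx : Measurable (S.x t)) (ha : Measurable (S.a t))
    (hb : Measurable (S.b t)) : Measurable (S.meanOutcome w t) :=
  (measurable_linPref_apply w).comp (hx.prodMk (ha.prodMk hb))

omit m in
theorem measurable_entry_contextInfo {s : ℕ} (hs : s < t) : Measurable[S.contextInfo t]
    fun ω => (S.x s ω, S.P s ω, S.a s ω, S.b s ω, S.o s ω) := by
  have : Measurable fun z : (Fin t → Context K d × PairMatrix K × Fin K × Fin K × ℝ) ×
      Context K d => z.1 ⟨s, hs⟩ := by fun_prop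
  exact this.comp (comap_measurable fun ω => (S.past t ω, S.x t ω))

omit m in
theorem measurable_feature_contextInfo {s : ℕ} (hs : s < t) :
    Measurable[S.contextInfo t] (S.feature s) := by
  have := S.measurable_entry_contextInfo hs
  exact measurable_feature this.fst this.snd.snd.fst this.snd.snd.snd.fst

omit m in
theorem measurable_noiseSum_contextInfo (w : Fin d → ℝ) :
    Measurable[S.contextInfo t] (S.noiseSum w t) := by
  refine measurable_noiseSum (fun s hs => measurable_feature_contextInfo hs) (fun s hs => ?_)
    fun s hs => ?_
  · exact (S.measurable_entry_contextInfo hs).snd.snd.snd.snd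
  · have := S.measurable_entry_contextInfo hs
    exact measurable_meanOutcome w this.fst this.snd.snd.fst this.snd.snd.snd.fst

omit m in
theorem measurable_x_contextInfo : Measurable[S.contextInfo t] (S.x t) :=
  measurable_snd.comp (comap_measurable fun ω => (S.past t ω, S.x t ω))

omit m in
theorem measurable_duel_duelInfo : Measurable[S.duelInfo t]
    fun ω => (S.x t ω, S.a t ω, S.b t ω) :=
  measurable_snd.comp (comap_measurable fun ω => (S.past t ω, S.x t ω, S.a t ω, S.b t ω))

end Measurability

namespace IsDuelingBandit

variable {S} [mΩ : MeasurableSpace Ω] {μ : Measure Ω} [IsProbabilityMeasure μ] {T t : ℕ}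
  {X : Set (Context K d)} {D : Measure (Context K d × PairMatrix K)} {w : Fin d → ℝ}

omit [IsProbabilityMeasure μ] in
theorem ae_isRegular (hS : S.IsDuelingBandit μ T D) (hD : IsLinDB X D w) :
    ∀ᵐ ω ∂μ, S.IsRegular X T ω := by
  unfold IsRegular
  rw [ae_all_iff]
  intro s
  by_cases hs : s < T
  · filter_upwards [hS.ae_of_law hs hD.context_mem, hS.outcome_mem s hs] with ω h1 h2 _
    exact ⟨h1, h2⟩
  · exact ae_of_all _ fun ω h => absurd h hs

omit [IsProbabilityMeasure μ] in
theorem measurable_mixSupermart (hS : S.IsDuelingBandit μ T D) (w : Fin d → ℝ) (ht : t ≤ T) :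
    Measurable (S.mixSupermart w t) := by
  have hf : ∀ s < t, Measurable (S.feature s) := fun s hs =>
    measurable_feature (hS.measurable_x s (by omega)) (hS.measurable_a s (by omega))
      (hS.measurable_b s (by omega))
  exact measurable_mixPotential (measurable_gram hf 1) (measurable_noiseSum hf
    (fun s hs => hS.measurable_o s (by omega)) fun s hs => measurable_meanOutcome w
      (hS.measurable_x s (by omega)) (hS.measurable_a s (by omega))
      (hS.measurable_b s (by omega)))

theorem integrable_mixSupermart (hS : S.IsDuelingBandit μ T D) (hD : IsLinDB X D w) (ht : t ≤ T) :
    Integrable (S.mixSupermart w t) μ := by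
  refine Integrable.of_bound (hS.measurable_mixSupermart w ht).aestronglyMeasurable
    (Real.exp (d * (2 * t) ^ 2 / 2)) ?_
  filter_upwards [hS.ae_isRegular hD] with ω h
  rw [Real.norm_of_nonneg (S.mixSupermart_nonneg _ _ _)]
  exact h.mixSupermart_le hD ht

/-- The increment is at most a bounded slope, known before the outcome, times the centred outcome;
this product integrates to zero. -/
theorem integral_mixSupermart_le_one (hS : S.IsDuelingBandit μ T D) (hD : IsLinDB X D w)
    (ht : t ≤ T) : ∫ ω, S.mixSupermart w t ω ∂μ ≤ 1 := by
  induction t with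
  | zero => simp [mixSupermart, mixPotential, gram_zero, noiseSum, invForm]
  | succ t ih =>
    have ht' : t < T := ht
    have ih := ih ht'.le
    set Q : ℝ → Ω → ℝ := fun o ω => mixPotential (S.gram 1 (t + 1) ω)
      (S.noiseSum w t ω + (o - S.meanOutcome w t ω) • S.feature t ω) with hQ
    set B := Real.exp (d * (2 * t + 2) ^ 2 / 2) with hB
    have mf : Measurable[S.duelInfo t] (S.feature t) := by
      have := S.measurable_duel_duelInfo (t := t)
      exact measurable_feature this.fst this.snd.fst this.snd.snd
    have mm : Measurable[S.duelInfo t] (S.meanOutcome w t) := by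
      have := S.measurable_duel_duelInfo (t := t)
      exact measurable_meanOutcome w this.fst this.snd.fst this.snd.snd
    -- `gram 1 (t + 1)` contains the feature of round `t`, hence `duelInfo` and not `contextInfo`.
    have mQ : ∀ o, Measurable[S.duelInfo t] (Q o) := by
      intro o
      refine measurable_mixPotential (measurable_gram (fun s hs => ?_) 1) ?_
      · rcases Nat.lt_succ_iff_lt_or_eq.1 hs with h | rfl
        · exact (measurable_feature_contextInfo h).mono (S.contextInfo_le_duelInfo t) le_rfl
        · exact mf
      · exact ((measurable_noiseSum_contextInfo w).mono (S.contextInfo_le_duelInfo t)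
          le_rfl).add ((measurable_const.sub mm).smul mf)
    have mY : Measurable[S.duelInfo t] fun ω => (Q 1 ω - Q (-1) ω) / 2 :=
      ((mQ 1).sub (mQ (-1))).div_const 2
    have bY : ∀ᵐ ω ∂μ, |(Q 1 ω - Q (-1) ω) / 2| ≤ B := by
      filter_upwards [hS.ae_isRegular hD] with ω h
      have h1 := h.mixPotential_le hD ht' (o := 1) (Or.inl rfl)
      have h2 := h.mixPotential_le hD ht' (o := -1) (Or.inr rfl)
      have h3 : 0 ≤ Q 1 ω := mixPotential_nonneg _ _
      have h4 : 0 ≤ Q (-1) ω := mixPotential_nonneg _ _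
      rw [abs_le]
      constructor <;> linarith
    have hle : S.duelInfo t ≤ mΩ := (S.duelInfo_le_preOutcome t).trans (hS.preOutcome_le ht')
    have iY : Integrable (fun ω => (Q 1 ω - Q (-1) ω) / 2) μ :=
      Integrable.of_bound (mY.mono hle le_rfl).aestronglyMeasurable B bY
    have io : Integrable (fun ω => (Q 1 ω - Q (-1) ω) / 2 * S.o t ω) μ := by
      refine iY.mul_bdd (c := 1) (hS.measurable_o t ht').aestronglyMeasurable ?_
      filter_upwards [hS.outcome_mem t ht'] with ω h
      rcases h with h | h <;> simp [h]
    have im : Integrable (fun ω => (Q 1 ω - Q (-1) ω) / 2 * S.meanOutcome w t ω) μ := by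
      refine iY.mul_bdd (c := 1) (mm.mono hle le_rfl).aestronglyMeasurable ?_
      filter_upwards [hS.ae_isRegular hD] with ω h
      exact abs_le.2 (h.meanOutcome_mem hD ht')
    have hzero := hS.integral_mul_outcome_linPref hD ht' mY bY
    have iM := hS.integrable_mixSupermart hD ht'.le
    calc ∫ ω, S.mixSupermart w (t + 1) ω ∂μ
        ≤ ∫ ω, (S.mixSupermart w t ω + ((Q 1 ω - Q (-1) ω) / 2 * S.o t ω -
          (Q 1 ω - Q (-1) ω) / 2 * S.meanOutcome w t ω)) ∂μ := by
          refine integral_mono_ae (hS.integrable_mixSupermart hD ht) (iM.add (io.sub im)) ?_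
          filter_upwards [hS.ae_isRegular hD] with ω h
          have := h.mixSupermart_succ_le hD ht'
          rwa [mul_sub] at this
      _ = ∫ ω, S.mixSupermart w t ω ∂μ + (∫ ω, (Q 1 ω - Q (-1) ω) / 2 * S.o t ω ∂μ -
          ∫ ω, (Q 1 ω - Q (-1) ω) / 2 * S.meanOutcome w t ω ∂μ) := by
          rw [← integral_sub io im]
          exact integral_add iM (io.sub im)
      _ ≤ 1 := by
          rw [hzero]
          unfold meanOutcome
          linarith

end IsDuelingBandit

end Interaction

/-! ### Equilibria, skew features and elementary inequalities. -/

/-- A linear functional on the simplex is maximal at a vertex. -/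
theorem iSup_stdSimplex_eq {K : ℕ} [Nonempty (Fin K)] (g : Fin K → ℝ) :
    ⨆ q : stdSimplex ℝ (Fin K), (1 / 2 : ℝ) * ∑ c, q.1 c * g c = ⨆ c, (1 / 2 : ℝ) * g c := by
  have hb : BddAbove (Set.range fun c => (1 / 2 : ℝ) * g c) := (Set.finite_range _).bddAbove
  have hle : ∀ q : stdSimplex ℝ (Fin K),
      (1 / 2 : ℝ) * ∑ c, q.1 c * g c ≤ ⨆ c, (1 / 2 : ℝ) * g c := by
    intro q
    calc (1 / 2 : ℝ) * ∑ c, q.1 c * g c = ∑ c, q.1 c * ((1 / 2 : ℝ) * g c) := by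
          rw [Finset.mul_sum]
          exact Finset.sum_congr rfl fun c _ => by ring
      _ ≤ ∑ c, q.1 c * ⨆ c, (1 / 2 : ℝ) * g c :=
          Finset.sum_le_sum fun c _ => mul_le_mul_of_nonneg_left (le_ciSup hb c) (q.2.1 c)
      _ = _ := by rw [← Finset.sum_mul, q.2.2, one_mul]
  let v : Fin K → stdSimplex ℝ (Fin K) := fun c => ⟨Pi.single c 1, single_mem_stdSimplex ℝ c⟩
  have : Nonempty (stdSimplex ℝ (Fin K)) := ⟨v (Classical.arbitrary _)⟩
  refine le_antisymm (ciSup_le hle) (ciSup_le fun c => ?_)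
  refine le_ciSup_of_le ⟨_, Set.forall_mem_range.2 hle⟩ (v c) (le_of_eq ?_)
  simp [v, Pi.single_apply]

/-- Under a coarse correlated equilibrium of an upper bound `U` of `F`, best responses against
`F` gain at most the symmetric part of `U`. -/
theorem IsCCE.deviation_le {K : ℕ} {U F p : PairMatrix K} (h : IsCCE U p)
    (hF : ∀ a b, F a b ≤ U a b) (c : Fin K) :
    ∑ a, ∑ b, p a b * (F c a + F c b) ≤ ∑ a, ∑ b, p a b * (U a b + U b a) := by
  have hl : ∑ a, ∑ b, p a b * F c a ≤ ∑ a, leftMarginal p a * U c a := by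
    refine Finset.sum_le_sum fun a _ => ?_
    rw [leftMarginal, ← Finset.sum_mul]
    exact mul_le_mul_of_nonneg_left (hF c a) (Finset.sum_nonneg fun b _ => h.dist.1 a b)
  have hr : ∑ a, ∑ b, p a b * F c b ≤ ∑ b, rightMarginal p b * U c b := by
    rw [Finset.sum_comm]
    refine Finset.sum_le_sum fun b _ => ?_
    rw [rightMarginal, ← Finset.sum_mul]
    exact mul_le_mul_of_nonneg_left (hF c b) (Finset.sum_nonneg fun a _ => h.dist.1 a b)
  simp only [mul_add, Finset.sum_add_distrib]
  -- `row` controls the deviation against the right marginal, `col` the one against the left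
  -- marginal.
  linarith [h.row c, h.col c]

/-- As features lie in `[-1, 1]`, each coordinate vector is a parameter of the class, and its
preference function reads off one coordinate of the features. -/
theorem IsLinDB.feature_skew {K d : ℕ} {X : Set (Context K d)}
    {D : Measure (Context K d × PairMatrix K)} {w : Fin d → ℝ} (h : IsLinDB X D w)
    {x : Context K d} (hx : x ∈ X) (a b : Fin K) : x a b = -x b a := by
  funext i
  have hv : (Pi.single i 1 : Fin d → ℝ) ∈ linClass X := by
    refine ⟨fun j => ?_, fun y hy a b => ?_⟩
    · rcases eq_or_ne j i with rfl | hj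
      · simp
      · simp [hj]
    · simpa [linPref] using h.feature_mem y hy a b i
  simpa [linPref] using h.skew _ hv x hx a b

theorem min_one_le_two_mul_log {q : ℝ} (hq : 0 ≤ q) : min 1 q ≤ 2 * Real.log (1 + q) := by
  have h := Real.le_log_one_add_of_nonneg hq
  have h2 : min 1 q ≤ 2 * (2 * q / (q + 2)) := by
    rw [← mul_div_assoc, le_div_iff₀ (by linarith)]
    rcases le_total q 1 with h1 | h1
    · rw [min_eq_right h1]
      nlinarith
    · rw [min_eq_left h1]
      linarith
  linarith

/-- For `λ = 1` squared widths may exceed `1`. Such a round is charged the maximal width `√r`, and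
the elliptical potential limits how many there are. -/
theorem sqrt_le_sqrt_min_add {q r : ℝ} (hq : 0 ≤ q) (hr : q ≤ r) :
    √q ≤ √(min 1 q) + √r * min 1 q := by
  rcases le_total q 1 with h1 | h1
  · rw [min_eq_right h1]
    have := mul_nonneg (Real.sqrt_nonneg r) hq
    linarith
  · rw [min_eq_left h1]
    have := Real.sqrt_le_sqrt hr
    simp only [Real.sqrt_one, mul_one]
    linarith

theorem sum_sqrt_le {T : ℕ} {f : ℕ → ℝ} (hf : ∀ t, 0 ≤ f t) :
    ∑ t ∈ Finset.range T, √(f t) ≤ √(T * ∑ t ∈ Finset.range T, f t) := by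
  refine Real.le_sqrt_of_sq_le ?_
  have := sq_sum_le_card_mul_sum_sq (s := Finset.range T) (f := fun t => √(f t))
  simpa only [Finset.card_range, Real.sq_sqrt (hf _)] using this

/-! ### Confidence ellipsoid, total width and regret on a fixed sample path. -/

namespace Interaction

variable {Ω : Type*} {K d : ℕ} (S : Interaction Ω K d)

/-- The width of the confidence ellipsoid in the direction of the features of a pair. -/
def pairWidth (t : ℕ) (a b : Fin K) (ω : Ω) : ℝ :=
  √(invForm (S.gram 1 t ω) (S.x t ω a b) (S.x t ω a b))

/-- The best-response regret of round `t`. -/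
def roundRegret (w : Fin d → ℝ) (t : ℕ) (ω : Ω) : ℝ :=
  ⨆ q : stdSimplex ℝ (Fin K),
    (1 / 2 : ℝ) * ∑ c, q.1 c * ∑ a, ∑ b, S.p t ω a b *
      (linPref w (S.x t ω) c a + linPref w (S.x t ω) c b)

theorem roundRegret_eq [Nonempty (Fin K)] (w : Fin d → ℝ) (t : ℕ) (ω : Ω) :
    S.roundRegret w t ω = ⨆ c, (1 / 2 : ℝ) * ∑ a, ∑ b, S.p t ω a b *
      (linPref w (S.x t ω) c a + linPref w (S.x t ω) c b) :=
  iSup_stdSimplex_eq _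

theorem ridge_eq (t : ℕ) (ω : Ω) : S.ridge 1 t ω = (S.gram 1 t ω)⁻¹ *ᵥ
    ∑ s ∈ Finset.range t, S.o s ω • S.feature s ω := by
  have h1 : (S.design t ω)ᵀ * S.design t ω + (1 : ℝ) • (1 : Matrix (Fin d) (Fin d) ℝ) =
      S.gram 1 t ω := by
    rw [gram, add_comm]
    congr 1
    ext i j
    rw [Matrix.mul_apply, Matrix.sum_apply,
      Finset.sum_range fun s => Matrix.vecMulVec (S.x s ω (S.a s ω) (S.b s ω))
        (S.x s ω (S.a s ω) (S.b s ω)) i j]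
    rfl
  have h2 : (S.design t ω)ᵀ *ᵥ S.response t ω =
      ∑ s ∈ Finset.range t, S.o s ω • S.feature s ω := by
    ext i
    rw [Finset.sum_apply, Finset.sum_range fun s => (S.o s ω • S.feature s ω) i]
    simp only [Matrix.mulVec, dotProduct, Pi.smul_apply, smul_eq_mul]
    exact Finset.sum_congr rfl fun s _ => mul_comm _ _
  rw [ridge, h1, h2]

/-- An outcome is its noise plus `feature ⬝ᵥ w`, and the outer products of the features sum to `V -
I`; the term `-w` becomes the bias of ridge regression. -/
theorem sum_outcome_eq (w : Fin d → ℝ) (t : ℕ) (ω : Ω) :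
    ∑ s ∈ Finset.range t, S.o s ω • S.feature s ω =
      S.noiseSum w t ω + (S.gram 1 t ω *ᵥ w - w) := by
  induction t with
  | zero => simp [noiseSum, gram_zero]
  | succ t ih =>
    rw [Finset.sum_range_succ, ih, noiseSum_succ, gram_succ, Matrix.add_mulVec,
      Matrix.vecMulVec_mulVec, op_smul_eq_smul]
    have : S.meanOutcome w t ω = S.feature t ω ⬝ᵥ w := dotProduct_comm w _
    rw [this, sub_smul]
    abel

/-- The error of the ridge estimate. -/
theorem ridge_dotProduct_sub (w : Fin d → ℝ) (t : ℕ) (ω : Ω) (y : Fin d → ℝ) :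
    S.ridge 1 t ω ⬝ᵥ y - w ⬝ᵥ y =
      invForm (S.gram 1 t ω) y (S.noiseSum w t ω) - invForm (S.gram 1 t ω) y w := by
  have hV : (S.gram 1 t ω)⁻¹ * S.gram 1 t ω = 1 :=
    Matrix.nonsing_inv_mul _ ((Matrix.isUnit_iff_isUnit_det _).1 (S.gram_posDef t ω).isUnit)
  rw [ridge_eq, S.sum_outcome_eq w, Matrix.mulVec_add, Matrix.mulVec_sub, Matrix.mulVec_mulVec,
    hV, Matrix.one_mulVec, add_dotProduct, sub_dotProduct, invForm, invForm,
    dotProduct_comm y, dotProduct_comm y]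
  ring

/-- Cauchy–Schwarz for `V⁻¹` on the noise and on the bias; the latter contributes `√d` since `wᵀ V⁻¹
w ≤ |w|² ≤ d`. -/
theorem abs_ridge_dotProduct_sub_le {w : Fin d → ℝ} (hw : ∀ i, w i ∈ Set.Icc (-1 : ℝ) 1)
    {t : ℕ} {ω : Ω} {η : ℝ}
    (hη : √(invForm (S.gram 1 t ω) (S.noiseSum w t ω) (S.noiseSum w t ω)) + √d ≤ η)
    (y : Fin d → ℝ) :
    |S.ridge 1 t ω ⬝ᵥ y - w ⬝ᵥ y| ≤ η * √(invForm (S.gram 1 t ω) y y) := by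
  have hV := S.gram_posDef t ω
  rw [ridge_dotProduct_sub]
  have h1 := abs_invForm_le hV y (S.noiseSum w t ω)
  have h2 := abs_invForm_le hV y w
  have h3 : √(invForm (S.gram 1 t ω) w w) ≤ √d := by
    refine Real.sqrt_le_sqrt ((invForm_self_le hV (S.gram_sub_one_posSemidef t ω) w).trans ?_)
    simpa using dotProduct_self_le fun i => abs_le.2 (hw i)
  calc _ ≤ _ := abs_sub _ _
    _ ≤ √(invForm (S.gram 1 t ω) y y) *
        (√(invForm (S.gram 1 t ω) (S.noiseSum w t ω) (S.noiseSum w t ω)) + √d) := by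
      rw [mul_add]
      exact add_le_add h1 (h2.trans (mul_le_mul_of_nonneg_left h3 (Real.sqrt_nonneg _)))
    _ ≤ _ := by
      rw [mul_comm]
      exact mul_le_mul_of_nonneg_right hη (Real.sqrt_nonneg _)

section Regular

variable {S} {X : Set (Context K d)} {D : Measure (Context K d × PairMatrix K)}
  {w : Fin d → ℝ} {T t : ℕ} {ω : Ω}

theorem IsRegular.invForm_feature_le (h : S.IsRegular X T ω) (hD : IsLinDB X D w) (ht : t < T)
    (a b : Fin K) : invForm (S.gram 1 t ω) (S.x t ω a b) (S.x t ω a b) ≤ d := by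
  refine (invForm_self_le (S.gram_posDef t ω) (S.gram_sub_one_posSemidef t ω) _).trans ?_
  simpa using dotProduct_self_le fun i => abs_le.2 (hD.feature_mem _ (h t ht).1 a b i)

theorem IsRegular.pairWidth_le (h : S.IsRegular X T ω) (hD : IsLinDB X D w) (ht : t < T)
    (a b : Fin K) : S.pairWidth t a b ω ≤ √d :=
  Real.sqrt_le_sqrt (h.invForm_feature_le hD ht a b)

/-- The elliptical potential lemma. -/
theorem IsRegular.sum_min_le (h : S.IsRegular X T ω) (hD : IsLinDB X D w) :
    ∑ t ∈ Finset.range T, min 1 (invForm (S.gram 1 t ω) (S.feature t ω) (S.feature t ω)) ≤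
      2 * (d * Real.log (1 + T)) := by
  have key : ∀ n : ℕ, ∑ t ∈ Finset.range n,
      min 1 (invForm (S.gram 1 t ω) (S.feature t ω) (S.feature t ω)) ≤
        2 * Real.log (S.gram 1 n ω).det := by
    intro n
    induction n with
    | zero => simp [gram_zero]
    | succ n ih =>
      have hV := S.gram_posDef n ω
      have hq := invForm_self_nonneg hV (S.feature n ω)
      -- Each round multiplies the determinant by `1 + q`, so the logarithms telescope.
      rw [Finset.sum_range_succ, gram_succ, det_add_vecMulVec_self hV,
        Real.log_mul hV.det_pos.ne' (by linarith)]
      linarith [min_one_le_two_mul_log hq]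
  refine (key T).trans ?_
  have := S.log_det_gram_le fun s hs i => h.abs_feature_le hD hs i
  linarith

theorem IsRegular.sum_pairWidth_le (h : S.IsRegular X T ω) (hD : IsLinDB X D w) :
    ∑ t ∈ Finset.range T, S.pairWidth t (S.a t ω) (S.b t ω) ω ≤
      √(T * (2 * (d * Real.log (1 + T)))) + √d * (2 * (d * Real.log (1 + T))) := by
  have hq := fun t => invForm_self_nonneg (S.gram_posDef t ω) (S.feature t ω)
  have hsum := h.sum_min_le hD
  calc ∑ t ∈ Finset.range T, S.pairWidth t (S.a t ω) (S.b t ω) ω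
      ≤ ∑ t ∈ Finset.range T,
        (√(min 1 (invForm (S.gram 1 t ω) (S.feature t ω) (S.feature t ω))) +
          √d * min 1 (invForm (S.gram 1 t ω) (S.feature t ω) (S.feature t ω))) :=
        Finset.sum_le_sum fun t ht => sqrt_le_sqrt_min_add (hq t)
          (h.invForm_feature_le hD (Finset.mem_range.1 ht) _ _)
    _ ≤ _ := by
        rw [Finset.sum_add_distrib, ← Finset.mul_sum]
        refine add_le_add ((sum_sqrt_le fun t => le_min zero_le_one (hq t)).trans ?_) ?_
        · exact Real.sqrt_le_sqrt (mul_le_mul_of_nonneg_left hsum (Nat.cast_nonneg T))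
        · exact mul_le_mul_of_nonneg_left hsum (Real.sqrt_nonneg _)

theorem IsRegular.abs_deviation_le (h : S.IsRegular X T ω) (hD : IsLinDB X D w) (ht : t < T)
    (hp : IsJointDist (S.p t ω)) (c : Fin K) :
    |(1 / 2 : ℝ) * ∑ a, ∑ b, S.p t ω a b *
      (linPref w (S.x t ω) c a + linPref w (S.x t ω) c b)| ≤ 1 := by
  have hF := fun a => hD.param_mem.2 _ (h t ht).1 c a
  have h2 : |∑ a, ∑ b, S.p t ω a b * (linPref w (S.x t ω) c a + linPref w (S.x t ω) c b)| ≤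
      ∑ a, ∑ b, S.p t ω a b * 2 := by
    refine (Finset.abs_sum_le_sum_abs _ _).trans (Finset.sum_le_sum fun a _ => ?_)
    refine (Finset.abs_sum_le_sum_abs _ _).trans (Finset.sum_le_sum fun b _ => ?_)
    rw [abs_mul, abs_of_nonneg (hp.1 a b)]
    refine mul_le_mul_of_nonneg_left ?_ (hp.1 a b)
    rw [abs_le]
    constructor <;> linarith [(hF a).1, (hF a).2, (hF b).1, (hF b).2]
  simp only [← Finset.sum_mul, hp.2] at h2
  rw [abs_mul, abs_of_pos (by norm_num : (0 : ℝ) < 1 / 2)]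
  linarith

theorem IsRegular.abs_roundRegret_le [Nonempty (Fin K)] (h : S.IsRegular X T ω)
    (hD : IsLinDB X D w) (ht : t < T) (hp : IsJointDist (S.p t ω)) :
    |S.roundRegret w t ω| ≤ 1 := by
  have hc := fun c => abs_le.1 (h.abs_deviation_le hD ht hp c)
  rw [roundRegret_eq, abs_le]
  refine ⟨?_, ciSup_le fun c => (hc c).2⟩
  exact le_ciSup_of_le (Set.finite_range _).bddAbove (Classical.arbitrary _) (hc _).1

/-- Degenerate cases in which all preferences vanish. They are treated apart because the claimed
bound is zero for `d = 0`, and for `K = 1` its logarithm does not dominate `log (1 + T)`. -/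
theorem IsRegular.roundRegret_eq_zero [Nonempty (Fin K)] (h : S.IsRegular X T ω)
    (hD : IsLinDB X D w) (ht : t < T) (hdK : d = 0 ∨ K ≤ 1) : S.roundRegret w t ω = 0 := by
  have h0 : ∀ a b, linPref w (S.x t ω) a b = 0 := by
    intro a b
    rcases hdK with rfl | hK
    · simp [linPref]
    · have : Subsingleton (Fin K) := Fin.subsingleton_iff_le_one.2 hK
      have := hD.skew w hD.param_mem _ (h t ht).1 a b
      rw [Subsingleton.elim b a] at this ⊢
      linarith
  rw [roundRegret_eq]
  simp [h0]

/-- On the event that the confidence ellipsoid contains the true parameter, the regret is at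
most the width of the ellipsoid in the directions played. -/
theorem IsRegular.roundRegret_le_of_confident [Nonempty (Fin K)] (h : S.IsRegular X T ω)
    (hD : IsLinDB X D w) (ht : t < T) {η : ℝ} (hη0 : 0 ≤ η)
    (hp : IsCCE (S.ucb 1 η t ω) (S.p t ω))
    (hη : √(invForm (S.gram 1 t ω) (S.noiseSum w t ω) (S.noiseSum w t ω)) + √d ≤ η) :
    S.roundRegret w t ω ≤ η * ∑ a, ∑ b, S.p t ω a b * S.pairWidth t a b ω := by
  have hx := (h t ht).1
  have hskew := hD.skew w hD.param_mem _ hx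
  have hF : ∀ a b, linPref w (S.x t ω) a b ≤ S.ucb 1 η t ω a b := by
    intro a b
    unfold ucb
    split_ifs with hab
    · subst hab
      linarith [hskew a a]
    · have := (abs_le.1 (S.abs_ridge_dotProduct_sub_le hD.param_mem.1 hη (S.x t ω a b))).1
      unfold invForm at this
      unfold linPref
      linarith
  have hU : ∀ a b, S.ucb 1 η t ω a b + S.ucb 1 η t ω b a ≤ 2 * η * S.pairWidth t a b ω := by
    intro a b
    unfold ucb
    by_cases hab : a = b
    · subst hab
      have : 0 ≤ S.pairWidth t a a ω := Real.sqrt_nonneg _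
      simp only [if_true, add_zero]
      positivity
    -- Since `x[b, a] = -x[a, b]`, the estimates cancel while the widths, even in the feature,
    -- agree.
    · rw [if_neg hab, if_neg (Ne.symm hab), hD.feature_skew hx b a]
      simp only [pairWidth, invForm, dotProduct_neg, neg_dotProduct, Matrix.mulVec_neg, neg_neg]
      linarith
  rw [roundRegret_eq]
  refine ciSup_le fun c => ?_
  have h1 := hp.deviation_le hF c
  have h2 : ∑ a, ∑ b, S.p t ω a b * (S.ucb 1 η t ω a b + S.ucb 1 η t ω b a) ≤
      2 * (η * ∑ a, ∑ b, S.p t ω a b * S.pairWidth t a b ω) := by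
    simp only [Finset.mul_sum]
    refine Finset.sum_le_sum fun a _ => Finset.sum_le_sum fun b _ => ?_
    refine (mul_le_mul_of_nonneg_left (hU a b) (hp.dist.1 a b)).trans (le_of_eq ?_)
    ring
  linarith

theorem IsRegular.invForm_noiseSum_le (h : S.IsRegular X T ω) (hD : IsLinDB X D w) (ht : t < T)
    (hM : S.mixSupermart w t ω < T) :
    invForm (S.gram 1 t ω) (S.noiseSum w t ω) (S.noiseSum w t ω) ≤
      2 * Real.log T + d * Real.log (1 + T) := by
  have hV := S.gram_posDef t ω
  have hT : (0 : ℝ) < T := by exact_mod_cast (Nat.zero_le t).trans_lt ht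
  have hs : 0 < √(S.gram 1 t ω).det := Real.sqrt_pos.2 hV.det_pos
  unfold mixSupermart mixPotential at hM
  rw [div_lt_iff₀ hs] at hM
  have h1 := Real.log_lt_log (Real.exp_pos _) hM
  rw [Real.log_exp, Real.log_mul hT.ne' hs.ne', Real.log_sqrt hV.det_pos.le] at h1
  have h2 := S.log_det_gram_le fun s hs i => h.abs_feature_le hD (hs.trans ht) i
  have h3 : (d : ℝ) * Real.log (1 + t) ≤ d * Real.log (1 + T) := by
    gcongr
  linarith

/-- Markov's inequality used pathwise: where `mixSupermart` reaches `T`, the term `mixSupermart / T`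
already exceeds the trivial regret bound `1`. -/
theorem IsRegular.roundRegret_le [Nonempty (Fin K)] (h : S.IsRegular X T ω)
    (hD : IsLinDB X D w) (ht : t < T) {η : ℝ}
    (hη : √(2 * Real.log T + d * Real.log (1 + T)) + √d ≤ η)
    (hp : IsCCE (S.ucb 1 η t ω) (S.p t ω)) :
    S.roundRegret w t ω ≤
      S.mixSupermart w t ω / T + η * ∑ a, ∑ b, S.p t ω a b * S.pairWidth t a b ω := by
  have hT : (0 : ℝ) < T := by exact_mod_cast (Nat.zero_le t).trans_lt ht
  have hη0 : 0 ≤ η := le_trans (by positivity) hη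
  have hM0 := S.mixSupermart_nonneg w t ω
  rcases lt_or_ge (S.mixSupermart w t ω) T with hM | hM
  · have h1 := h.roundRegret_le_of_confident hD ht hη0 hp
      (le_trans (by gcongr; exact h.invForm_noiseSum_le hD ht hM) hη)
    have := div_nonneg hM0 hT.le
    linarith
  · have h1 := (abs_le.1 (h.abs_roundRegret_le hD ht hp.dist)).2
    have h2 : 1 ≤ S.mixSupermart w t ω / T := (one_le_div hT).2 hM
    have h3 : 0 ≤ η * ∑ a, ∑ b, S.p t ω a b * S.pairWidth t a b ω :=
      mul_nonneg hη0 (Finset.sum_nonneg fun a _ => Finset.sum_nonneg fun b _ =>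
        mul_nonneg (hp.dist.1 a b) (Real.sqrt_nonneg _))
    linarith

end Regular

theorem measurable_pairWidth (t : ℕ) (i j : Fin K) :
    Measurable[S.preDuel t] (S.pairWidth t i j) := by
  have h := (measurable_pi_apply j).comp
    ((measurable_pi_apply i).comp (S.measurable_x_contextInfo (t := t)))
  have := measurable_invForm (measurable_gram (fun s hs => measurable_feature_contextInfo hs) 1)
    h h
  exact (this.mono (S.contextInfo_le_preDuel t) le_rfl).sqrt

/-! ### Regret in expectation. -/

namespace IsDuelingBandit

variable {S} [mΩ : MeasurableSpace Ω] {μ : Measure Ω} [IsProbabilityMeasure μ] {T t : ℕ}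
  {X : Set (Context K d)} {D : Measure (Context K d × PairMatrix K)} {w : Fin d → ℝ}

theorem integrable_roundRegret [Nonempty (Fin K)] (hS : S.IsDuelingBandit μ T D)
    (hD : IsLinDB X D w) (ht : t < T) : Integrable (S.roundRegret w t) μ := by
  have hp := fun i j => hS.measurable_p' ht i j
  have hl := fun i j => (measurable_linPref w i j).comp (hS.measurable_x t ht)
  have hm : Measurable (S.roundRegret w t) := by
    have : S.roundRegret w t = fun ω => ⨆ c, (1 / 2 : ℝ) * ∑ a, ∑ b, S.p t ω a b *
      (linPref w (S.x t ω) c a + linPref w (S.x t ω) c b) :=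
      funext fun ω => S.roundRegret_eq w t ω
    rw [this]
    refine Measurable.iSup fun c => measurable_const.mul ?_
    refine Finset.measurable_fun_sum _ fun a _ => Finset.measurable_fun_sum _ fun b _ => ?_
    exact (hp a b).mul ((hl c a).add (hl c b))
  refine Integrable.of_bound hm.aestronglyMeasurable 1 ?_
  filter_upwards [hS.ae_isRegular hD, hS.dist t ht] with ω h1 h2
  exact h1.abs_roundRegret_le hD ht h2

omit [IsProbabilityMeasure μ] in
theorem ae_abs_pairWidth_le (hS : S.IsDuelingBandit μ T D) (hD : IsLinDB X D w) (ht : t < T) :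
    ∀ᵐ ω ∂μ, ∀ i j, |S.pairWidth t i j ω| ≤ √d := by
  filter_upwards [hS.ae_isRegular hD] with ω h i j
  rw [pairWidth, abs_of_nonneg (Real.sqrt_nonneg _)]
  exact h.pairWidth_le hD ht i j

theorem integrable_p_mul_pairWidth (hS : S.IsDuelingBandit μ T D) (hD : IsLinDB X D w)
    (ht : t < T) (i j : Fin K) : Integrable (fun ω => S.p t ω i j * S.pairWidth t i j ω) μ := by
  have hw : Measurable (S.pairWidth t i j) :=
    (S.measurable_pairWidth t i j).mono (hS.preDuel_le ht) le_rfl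
  refine Integrable.of_bound ((hS.measurable_p' ht i j).mul hw).aestronglyMeasurable √d ?_
  filter_upwards [hS.ae_abs_pairWidth_le hD ht, hS.p_mem_Icc ht i j] with ω h1 h2
  rw [norm_mul, Real.norm_of_nonneg h2.1]
  exact (mul_le_of_le_one_left (norm_nonneg _) h2.2).trans (h1 i j)

theorem integrable_duelWidth (hS : S.IsDuelingBandit μ T D) (hD : IsLinDB X D w) (ht : t < T) :
    Integrable (fun ω => S.pairWidth t (S.a t ω) (S.b t ω) ω) μ := by
  have hf : ∀ s ≤ t, Measurable (S.feature s) := fun s hs =>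
    measurable_feature (hS.measurable_x s (by omega)) (hS.measurable_a s (by omega))
      (hS.measurable_b s (by omega))
  have hw : Measurable fun ω => S.pairWidth t (S.a t ω) (S.b t ω) ω :=
    (measurable_invForm (measurable_gram (fun s hs => hf s hs.le) 1) (hf t le_rfl)
      (hf t le_rfl)).sqrt
  refine Integrable.of_bound hw.aestronglyMeasurable √d ?_
  filter_upwards [hS.ae_abs_pairWidth_le hD ht] with ω h using h _ _

theorem integral_roundRegret_le [Nonempty (Fin K)] (hS : S.IsDuelingBandit μ T D)
    (hD : IsLinDB X D w) (ht : t < T) {η : ℝ}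
    (hη : √(2 * Real.log T + d * Real.log (1 + T)) + √d ≤ η)
    (hp : ∀ᵐ ω ∂μ, IsCCE (S.ucb 1 η t ω) (S.p t ω)) :
    ∫ ω, S.roundRegret w t ω ∂μ ≤
      1 / T + η * ∫ ω, S.pairWidth t (S.a t ω) (S.b t ω) ω ∂μ := by
  have hi := hS.integrable_p_mul_pairWidth hD ht
  have hi' : Integrable (fun ω => ∑ a, ∑ b, S.p t ω a b * S.pairWidth t a b ω) μ :=
    integrable_finsetSum _ fun a _ => integrable_finsetSum _ fun b _ => hi a b
  have hM := hS.integrable_mixSupermart hD ht.le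
  -- The widths of all pairs are known before the duel is drawn from `p t`.
  have hduel : ∫ ω, S.pairWidth t (S.a t ω) (S.b t ω) ω ∂μ =
      ∫ ω, ∑ a, ∑ b, S.p t ω a b * S.pairWidth t a b ω ∂μ := by
    rw [hS.integral_duel ht (S.measurable_pairWidth t)
      fun i j => (hS.ae_abs_pairWidth_le hD ht).mono fun ω h => h i j,
      integral_finsetSum _ fun a _ => integrable_finsetSum _ fun b _ => hi a b]
    refine Finset.sum_congr rfl fun a _ => ?_
    rw [integral_finsetSum _ fun b _ => hi a b]
    simp only [mul_comm]
  calc ∫ ω, S.roundRegret w t ω ∂μ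
      ≤ ∫ ω, (S.mixSupermart w t ω / T +
        η * ∑ a, ∑ b, S.p t ω a b * S.pairWidth t a b ω) ∂μ := by
        refine integral_mono_ae (hS.integrable_roundRegret hD ht)
          ((hM.div_const _).add (hi'.const_mul η)) ?_
        filter_upwards [hS.ae_isRegular hD, hp] with ω h1 h2
        exact h1.roundRegret_le hD ht hη h2
    _ = (∫ ω, S.mixSupermart w t ω ∂μ) / T + η * ∫ ω, S.pairWidth t (S.a t ω) (S.b t ω) ω ∂μ := by
        rw [hduel, integral_add (hM.div_const _) (hi'.const_mul η), integral_div,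
          integral_const_mul]
    _ ≤ _ := by
        gcongr
        exact hS.integral_mixSupermart_le_one hD ht.le

theorem integrable_brRegret [Nonempty (Fin K)] (hS : S.IsDuelingBandit μ T D)
    (hD : IsLinDB X D w) : Integrable (S.brRegret w T) μ :=
  integrable_finsetSum _ fun _ ht => hS.integrable_roundRegret hD (Finset.mem_range.1 ht)

theorem integral_brRegret [Nonempty (Fin K)] (hS : S.IsDuelingBandit μ T D)
    (hD : IsLinDB X D w) :
    ∫ ω, S.brRegret w T ω ∂μ = ∑ t ∈ Finset.range T, ∫ ω, S.roundRegret w t ω ∂μ :=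
  integral_finsetSum _ fun _ ht => hS.integrable_roundRegret hD (Finset.mem_range.1 ht)

theorem integral_brRegret_le_card [Nonempty (Fin K)] (hS : S.IsDuelingBandit μ T D)
    (hD : IsLinDB X D w) : ∫ ω, S.brRegret w T ω ∂μ ≤ T := by
  rw [hS.integral_brRegret hD]
  have : ∑ t ∈ Finset.range T, ∫ ω, S.roundRegret w t ω ∂μ ≤
      ∑ t ∈ Finset.range T, (1 : ℝ) := by
    refine Finset.sum_le_sum fun t ht => ?_
    have ht := Finset.mem_range.1 ht
    calc ∫ ω, S.roundRegret w t ω ∂μ ≤ ∫ _ω, (1 : ℝ) ∂μ := by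
          refine integral_mono_ae (hS.integrable_roundRegret hD ht) (integrable_const _) ?_
          filter_upwards [hS.ae_isRegular hD, hS.dist t ht] with ω h1 h2
          exact (abs_le.1 (h1.abs_roundRegret_le hD ht h2)).2
      _ = 1 := by simp
  simpa using this

theorem integral_brRegret_eq_zero [Nonempty (Fin K)] (hS : S.IsDuelingBandit μ T D)
    (hD : IsLinDB X D w) (hdK : d = 0 ∨ K ≤ 1) : ∫ ω, S.brRegret w T ω ∂μ = 0 := by
  rw [hS.integral_brRegret hD]
  refine Finset.sum_eq_zero fun t ht => ?_
  refine integral_eq_zero_of_ae ?_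
  filter_upwards [hS.ae_isRegular hD] with ω h
  exact h.roundRegret_eq_zero hD (Finset.mem_range.1 ht) hdK

theorem integral_brRegret_le [Nonempty (Fin K)] (hS : S.IsDuelingBandit μ T D)
    (hD : IsLinDB X D w) {η : ℝ}
    (hη : √(2 * Real.log T + d * Real.log (1 + T)) + √d ≤ η) (hp : S.PlaysCCElinDB μ T 1 η) :
    ∫ ω, S.brRegret w T ω ∂μ ≤
      1 + η * (√(T * (2 * (d * Real.log (1 + T)))) + √d * (2 * (d * Real.log (1 + T)))) := by
  have hη0 : 0 ≤ η := le_trans (by positivity) hη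
  have hi := fun t (ht : t ∈ Finset.range T) =>
    hS.integrable_duelWidth hD (Finset.mem_range.1 ht)
  rw [hS.integral_brRegret hD]
  calc ∑ t ∈ Finset.range T, ∫ ω, S.roundRegret w t ω ∂μ
      ≤ ∑ t ∈ Finset.range T, (1 / (T : ℝ) +
        η * ∫ ω, S.pairWidth t (S.a t ω) (S.b t ω) ω ∂μ) := by
        refine Finset.sum_le_sum fun t ht => ?_
        have ht := Finset.mem_range.1 ht
        exact hS.integral_roundRegret_le hD ht hη (hp t ht)
    _ = T * (1 / (T : ℝ)) +
        η * ∫ ω, ∑ t ∈ Finset.range T, S.pairWidth t (S.a t ω) (S.b t ω) ω ∂μ := by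
        rw [Finset.sum_add_distrib, ← Finset.mul_sum, integral_finsetSum _ hi]
        simp
    _ ≤ _ := by
        gcongr
        -- An inequality, so that `T = 0`, where `T / T = 0`, is included.
        · exact (mul_one_div (T : ℝ) T).trans_le (div_self_le_one _)
        · calc _ ≤ ∫ _ω, (√(T * (2 * (d * Real.log (1 + T)))) +
              √d * (2 * (d * Real.log (1 + T)))) ∂μ := by
                refine integral_mono_ae (integrable_finsetSum _ hi) (integrable_const _) ?_
                filter_upwards [hS.ae_isRegular hD] with ω h
                exact h.sum_pairWidth_le hD
            _ = _ := by simp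

end IsDuelingBandit

end Interaction

/-! ### Tuning and numerical constants. -/

/-- The confidence radius. -/
def confidenceRadius (d K T : ℕ) : ℝ := 1 + √d + √(3 * d * Real.log (K * T))

theorem confidenceRadius_pos (d K T : ℕ) : 0 < confidenceRadius d K T := by
  unfold confidenceRadius
  positivity

section Numeric

variable {d K T : ℕ}

theorem log_one_add_le (hK : 2 ≤ K) (hT : 1 ≤ T) :
    Real.log (1 + T) ≤ Real.log (K * T) := by
  have hK' : (2 : ℝ) ≤ K := by exact_mod_cast hK
  have hT' : (1 : ℝ) ≤ T := by exact_mod_cast hT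
  refine Real.log_le_log (by positivity) ?_
  nlinarith

/-- The factor `3` is `2 + 1`, as `2 log T ≤ 2 d log(KT)`. The summand `1` of the radius only
ensures positivity when `d = 0`. -/
theorem le_confidenceRadius (hd : 1 ≤ d) (hK : 2 ≤ K) (hT : 1 ≤ T) :
    √(2 * Real.log T + d * Real.log (1 + T)) + √d ≤ confidenceRadius d K T := by
  have hd' : (1 : ℝ) ≤ d := by exact_mod_cast hd
  have hT' : (1 : ℝ) ≤ T := by exact_mod_cast hT
  have h1 := log_one_add_le hK hT
  have h2 : Real.log T ≤ Real.log (1 + T) := Real.log_le_log (by positivity) (by linarith)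
  have h3 := Real.log_nonneg hT'
  have h4 : √(2 * Real.log T + d * Real.log (1 + T)) ≤ √(3 * d * Real.log (K * T)) := by
    refine Real.sqrt_le_sqrt ?_
    nlinarith
  unfold confidenceRadius
  linarith

theorem regret_bound_le (hd : 1 ≤ d) (hK : 2 ≤ K) (hT : 1 ≤ T) {R : ℝ} (hR : R ≤ T)
    (h : R ≤ 1 + confidenceRadius d K T *
      (√(T * (2 * (d * Real.log (1 + T)))) + √d * (2 * (d * Real.log (1 + T))))) :
    R ≤ 20 * d * Real.log (K * T) * √T := by
  have hd' : (1 : ℝ) ≤ d := by exact_mod_cast hd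
  have hT' : (1 : ℝ) ≤ T := by exact_mod_cast hT
  have hlog := log_one_add_le hK hT
  have hlog0 : 0 ≤ Real.log (1 + T) := Real.log_nonneg (by linarith)
  have hlog2 : Real.log 2 ≤ Real.log (1 + T) := Real.log_le_log (by norm_num) (by linarith)
  have hl2 := Real.log_two_gt_d9
  unfold confidenceRadius at h
  set L := Real.log (K * T) with hL
  have hL0 : 0 ≤ L := hlog0.trans hlog
  obtain ⟨r, hr⟩ : ∃ r, r = √(d : ℝ) := ⟨_, rfl⟩
  obtain ⟨l, hl⟩ : ∃ l, l = √L := ⟨_, rfl⟩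
  obtain ⟨s, hs⟩ : ∃ s, s = √(T : ℝ) := ⟨_, rfl⟩
  have hr2 : r ^ 2 = d := by rw [hr, Real.sq_sqrt (by linarith)]
  have hl2' : l ^ 2 = L := by rw [hl, Real.sq_sqrt hL0]
  have hs2 : s ^ 2 = T := by rw [hs, Real.sq_sqrt (by linarith)]
  have hr1 : 1 ≤ r := by rw [hr, Real.one_le_sqrt]; exact hd'
  have hs1 : 1 ≤ s := by rw [hs, Real.one_le_sqrt]; exact hT'
  -- `0.8² = 0.64 < log 2 ≤ L`.
  have hl1 : 0.8 ≤ l := by rw [hl]; exact Real.le_sqrt_of_sq_le (by linarith)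
  have e1 : √(3 * d * L) ≤ 2 * (r * l) := by
    refine Real.sqrt_le_iff.2 ⟨by positivity, ?_⟩
    rw [mul_pow, mul_pow, hr2, hl2']
    nlinarith [mul_nonneg (zero_le_one.trans hd') hL0]
  have e2 : √(T * (2 * (d * Real.log (1 + T)))) ≤ 1.5 * (s * r * l) := by
    refine Real.sqrt_le_iff.2 ⟨by positivity, ?_⟩
    rw [mul_pow, mul_pow, mul_pow, hr2, hl2', hs2]
    have : (T : ℝ) * d * Real.log (1 + T) ≤ T * d * L := by gcongr
    nlinarith [mul_nonneg (mul_nonneg (zero_le_one.trans hT') (zero_le_one.trans hd')) hL0]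
  have e3 : √d * (2 * (d * Real.log (1 + T))) ≤ 2 * (r ^ 3 * l ^ 2) := by
    rw [← hr, ← hr2, hl2']
    have : r ^ 3 * Real.log (1 + T) ≤ r ^ 3 * L := by gcongr
    linarith
  have hrl : 0.8 * r ≤ r * l := by nlinarith
  have e4 : 1 + √d + √(3 * d * L) ≤ 5 * (r * l) := by
    rw [← hr]
    linarith
  have goal : R ≤ 20 * (r ^ 2 * l ^ 2 * s) := by
    have hB : 0 ≤ r ^ 2 * l * s := by positivity
    -- If `√T ≤ d √L`, the trivial bound gives `T ≤ d √L √T`. Otherwise the lower-order width term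
    -- is absorbed, and the constants add up to `7.5 + 10 + 1 / 0.64 < 20`.
    rcases le_total s (r ^ 2 * l) with hcase | hcase
    · have h1 : s ^ 2 ≤ r ^ 2 * l * s := by
        rw [sq]
        exact mul_le_mul_of_nonneg_right hcase (by linarith)
      have h2 : r ^ 2 * l * s * 0.8 ≤ r ^ 2 * l * s * l := mul_le_mul_of_nonneg_left hl1 hB
      rw [← hs2] at hR
      linarith
    · have h1 : (1 + √d + √(3 * d * L)) *
          (√(T * (2 * (d * Real.log (1 + T)))) + √d * (2 * (d * Real.log (1 + T)))) ≤
          5 * (r * l) * (1.5 * (s * r * l) + 2 * (r ^ 3 * l ^ 2)) :=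
        mul_le_mul e4 (add_le_add e2 e3) (by positivity) (by positivity)
      have h2 : r ^ 2 * l ^ 2 * (r ^ 2 * l) ≤ r ^ 2 * l ^ 2 * s :=
        mul_le_mul_of_nonneg_left hcase (by positivity)
      have h3 : (0.64 : ℝ) ≤ r ^ 2 * l ^ 2 * s := by
        have : (1 : ℝ) ^ 2 * 0.8 ^ 2 * 1 ≤ r ^ 2 * l ^ 2 * s := by gcongr
        linarith
      have h4 : 5 * (r * l) * (1.5 * (s * r * l) + 2 * (r ^ 3 * l ^ 2)) =
          7.5 * (r ^ 2 * l ^ 2 * s) + 10 * (r ^ 2 * l ^ 2 * (r ^ 2 * l)) := by ring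
      linarith
  rw [← hs, ← hr2, ← hl2']
  linarith

end Numeric

end DuelingBandit

end

theorem theorem4 :
    ∃ C : ℝ, 0 < C ∧ ∃ lam η : ℕ → ℕ → ℕ → ℝ,
      (∀ d K T : ℕ, 0 < lam d K T ∧ 0 < η d K T) ∧
      ∀ (d K T : ℕ) (X : Set (DuelingBandit.Context K d))
        (D : Measure (DuelingBandit.Context K d × DuelingBandit.PairMatrix K))
        (w : Fin d → ℝ), DuelingBandit.IsLinDB X D w →
      ∀ (Ω : Type*) [MeasurableSpace Ω] (μ : Measure Ω) [IsProbabilityMeasure μ]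
        (S : DuelingBandit.Interaction Ω K d),
        S.IsDuelingBandit μ T D →
        S.PlaysCCElinDB μ T (lam d K T) (η d K T) →
        Integrable (S.brRegret w T) μ ∧
          ∫ ω, S.brRegret w T ω ∂μ ≤ C * d * Real.log (K * T) * √T := by
  refine ⟨20, by norm_num, fun _ _ _ => 1, DuelingBandit.confidenceRadius,
    fun d K T => ⟨one_pos, DuelingBandit.confidenceRadius_pos d K T⟩, ?_⟩
  intro d K T X D w hD Ω _ μ _ S hS hp
  obtain ⟨ω⟩ : Nonempty Ω := nonempty_of_isProbabilityMeasure μ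
  -- `S.a` is defined in every round, even if `T = 0`, so `K = 0` is impossible.
  have : Nonempty (Fin K) := ⟨S.a 0 ω⟩
  refine ⟨hS.integrable_brRegret hD, ?_⟩
  by_cases hdK : d = 0 ∨ K ≤ 1
  · rw [hS.integral_brRegret_eq_zero hD hdK]
    have : 0 ≤ Real.log (K * T) := by exact_mod_cast Real.log_natCast_nonneg (K * T)
    positivity
  rcases Nat.eq_zero_or_pos T with rfl | hT
  · simp [DuelingBandit.Interaction.brRegret]
  have hd : 1 ≤ d := by omega
  have hK : 2 ≤ K := by omega
  exact DuelingBandit.regret_bound_le hd hK hT (hS.integral_brRegret_le_card hD)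
    (hS.integral_brRegret_le hD (DuelingBandit.le_confidenceRadius hd hK hT) hp)
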